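/- Let $k$ be a field of characteristic $p\ge 3$. A super vector space is a $\mathbb Z/2$-graded $k$-vector space $V=V_0\oplus V_1$; $\mathfrak{svec}$ is the category of super vector spaces and all linear maps, and $\boldsymbol{\mathcal V}$ is its full subcategory of finite dimensional objects. The space $\mathrm{Hom}(V,W)$ of all linear maps is a super vector space: maps of parity $i$ send $V_j$ to $W_{i+j}$. For a super vector space $V$, let $\boldsymbol\Gamma^nV$ be the subspace of invariants of $V^{\otimes n}$ under the symmetric group $\Sigma_n$, where the transposition $(i,i+1)$ exchanges the homogeneous factors $v_i$ and $v_{i+1}$ with the sign $(-1)^{\overline{v_i}\,\overline{v_{i+1}}}$; it is graded by total parity. The category $\boldsymbol\Gamma^n\boldsymbol{\mathcal V}$ has the objects of $\boldsymbol{\mathcal V}$ and the morphisms $\boldsymbol\Gamma^n\mathrm{Hom}(V,W)$, composed through $\boldsymbol\Gamma^n\mathrm{Hom}(V,W)\simeq\mathrm{Hom}_{k\Sigma_n}(V^{\otimes n},W^{\otimes n})$, that is by $(f_1\otimes\cdots\otimes f_n)(g_1\otimes\cdots\otimes g_n)=(-1)^{\sum_{a>b}\overline{f_a}\,\overline{g_b}}f_1g_1\otimes\cdots\otimes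 f_ng_n$ for homogeneous $f_a,g_b$. A superfunctor of degree $n$ is a functor $A:\boldsymbol\Gamma^n\boldsymbol{\mathcal V}\to\mathfrak{svec}$ for which all maps $\boldsymbol\Gamma^n\mathrm{Hom}(V,W)\to\mathrm{Hom}(A(V),A(W))$ are linear and even; it is additive if the inclusions induce isomorphisms $A(V)\oplus A(W)\simeq A(V\oplus W)$ for all $V,W$. For a superlinear category $\mathcal C$ (one enriched over $\mathfrak{svec}$), $\mathcal C_{ev}$ is the category with the same objects and only the even morphisms. Let $(\boldsymbol{\mathcal P}_n)_{ev}$ be the category of superfunctors of degree $n$ with finite dimensional values and even natural transformations. Let $\mathcal P_d$ ($d\ge 0$) be the category of strict polynomial functors of degree $d$, that is of $k$-linear functors $F:\Gamma^d\mathcal V\to\mathcal V$ ($\mathcal V$ being the category of finite dimensional vector spaces, $\Gamma^d\mathcal V$ the category with the same objects and the morphisms $\Gamma^d\mathrm{Hom}(V,W)=(\mathrm{Hom}(V,W)^{\otimes d})^{\Sigma_d}$). For $X\in\boldsymbol{\mathcal V}$ and $F\in\mathcal P_d$, regard $F(X)$ as a super vector space as follows: let $\mathbb G_m$ act on $X$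 with weight $0$ on $X_0$ and weight $1$ on $X_1$, and reduce modulo $2$ the weights of the induced action on $F(X)$. Let $r>0$ and let $A$ be an additive superfunctor of degree $p^r$. (1) For every morphism $f$ of $\boldsymbol\Gamma^{p^r}\boldsymbol{\mathcal V}$ the map $A(f)$ is even. Hence $A$ restricts to a superlinear functor $\boldsymbol\Gamma^{p^r}\boldsymbol{\mathcal V}\to\mathfrak{svec}_{ev}$, that is, $A$ is the composite of such a functor with the inclusion $\mathfrak{svec}_{ev}\to\mathfrak{svec}$. (2) If $A$ has finite dimensional values, then for every $d\ge 0$ precomposition by $A$ is an exact functor (one that preserves finite limits and finite colimits) $$-\circ A:\mathcal P_d\to(\boldsymbol{\mathcal P}_{p^rd})_{ev}.$$ Here $(F\circ A)(V)=F(A(V))$ as a super vector space; on morphisms $F\circ A$ is the composite $$\boldsymbol\Gamma^{p^rd}\mathrm{Hom}(V,W)\to\boldsymbol\Gamma^d(\boldsymbol\Gamma^{p^r}\mathrm{Hom}(V,W))\xrightarrow{\boldsymbol\Gamma^dA}\Gamma^d\mathrm{Hom}(A(V),A(W))\xrightarrow{F}\mathrm{Hom}(F(A(V)),F(A(W))),$$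 where the first map is the inclusion of invariants given by $\Sigma_{p^r}^{\times d}\subset\Sigma_{p^rd}$ and the second one takes values in the ordinary invariants because of (1); and for $\varphi:F\to G$ in $\mathcal P_d$, $(\varphi\circ A)_V=\varphi_{A(V)}$. -/

import Mathlib

open CategoryTheory TensorProduct

universe u

/-! ## Super vector spaces -/

/-- A super vector space over `k`: a vector space with a decomposition `V = V_0 ⊕ V_1`. -/
structure SVec (k : Type u) [Field k] where
  carrier : Type u
  [addCommGroup : AddCommGroup carrier]
  [module : Module k carrier]
  /-- `gr 0` is the even part, `gr 1` the odd part -/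
  gr : ZMod 2 → Submodule k carrier
  isCompl : IsCompl (gr 0) (gr 1)

attribute [instance] SVec.addCommGroup SVec.module

namespace SVec

variable {k : Type u} [Field k]

instance : CoeSort (SVec k) (Type u) := ⟨SVec.carrier⟩

theorem isCompl_add_one (V : SVec k) (i : ZMod 2) : IsCompl (V.gr i) (V.gr (i + 1)) := by
  fin_cases i
  · exact V.isCompl
  · exact V.isCompl.symm

theorem add_one_ne (i : ZMod 2) : i + 1 ≠ i := by
  revert i; decide

theorem eq_add_one (i j : ZMod 2) (h : i ≠ j) : j = i + 1 := by
  revert i j; decide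

/-- The projection of `V` onto its homogeneous part of parity `i`. -/
noncomputable def proj (V : SVec k) (i : ZMod 2) : V →ₗ[k] V :=
  (V.gr i).projection (V.gr (i + 1)) (V.isCompl_add_one i)

theorem proj_mem (V : SVec k) (i : ZMod 2) (v : V) : V.proj i v ∈ V.gr i :=
  Submodule.projection_apply_mem _ _

theorem proj_of_mem (V : SVec k) (i j : ZMod 2) (v : V) (hv : v ∈ V.gr j) :
    V.proj i v = if i = j then v else 0 := by
  split_ifs with h
  · subst h
    exact Submodule.projection_apply_of_mem_left _ hv
  · have : j = i + 1 := eq_add_one i j h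
    subst this
    exact Submodule.projection_apply_of_mem_right _ hv

theorem proj_add_proj (V : SVec k) (v : V) : V.proj 0 v + V.proj 1 v = v := by
  have h : v ∈ V.gr 0 ⊔ V.gr 1 := by rw [V.isCompl.sup_eq_top]; trivial
  obtain ⟨a, ha, b, hb, rfl⟩ := Submodule.mem_sup.1 h
  rw [map_add, map_add, V.proj_of_mem 0 0 a ha, V.proj_of_mem 0 1 b hb, V.proj_of_mem 1 0 a ha,
    V.proj_of_mem 1 1 b hb]
  simp

theorem sum_proj (V : SVec k) (v : V) : ∑ i, V.proj i v = v := by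
  have : (∑ i : ZMod 2, V.proj i v) = V.proj 0 v + V.proj 1 v := Fin.sum_univ_two _
  rw [this, proj_add_proj]

theorem isCompl_of_proj {M : Type u} [AddCommGroup M] [Module k M] (G : ZMod 2 → Submodule k M)
    (P : ZMod 2 → M →ₗ[k] M) (hmem : ∀ i x, P i x ∈ G i) (hsum : ∀ x, P 0 x + P 1 x = x)
    (hzero : ∀ i, ∀ x ∈ G i, P (i + 1) x = 0) : IsCompl (G 0) (G 1) := by
  constructor
  · rw [Submodule.disjoint_def]
    intro x h0 h1
    have a := hzero 0 x h0
    have b := hzero 1 x h1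
    rw [show (1 + 1 : ZMod 2) = 0 from rfl] at b
    rw [show (0 + 1 : ZMod 2) = 1 from rfl] at a
    rw [← hsum x, a, b, add_zero]
  · rw [codisjoint_iff, eq_top_iff]
    intro x _
    rw [← hsum x]
    exact Submodule.add_mem_sup (hmem 0 x) (hmem 1 x)

/-- The linear maps `V → W` of parity `i`: those sending `V_j` to `W_{i+j}`. -/
def ihomGr (V W : SVec k) (i : ZMod 2) : Submodule k (V →ₗ[k] W) where
  carrier := {f | ∀ j, ∀ v ∈ V.gr j, f v ∈ W.gr (i + j)}
  add_mem' := fun hf hg j v hv => add_mem (hf j v hv) (hg j v hv)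
  zero_mem' := fun _ _ _ => zero_mem _
  smul_mem' := fun c _ hf j v hv => Submodule.smul_mem _ c (hf j v hv)

/-- The super vector space of all linear maps `V → W`. -/
def ihom (V W : SVec k) : SVec k where
  carrier := V →ₗ[k] W
  gr := ihomGr V W
  isCompl := by
    refine isCompl_of_proj (ihomGr V W)
      (fun i => ∑ j, (LinearMap.llcomp k V W W (W.proj (i + j)) :
        (V →ₗ[k] W) →ₗ[k] (V →ₗ[k] W)) ∘ₗ
          ((LinearMap.llcomp k V V W).flip (V.proj j) : (V →ₗ[k] W) →ₗ[k] (V →ₗ[k] W))) ?_ ?_ ?_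
    · intro i f j v hv
      simp only [LinearMap.sum_apply, LinearMap.comp_apply, LinearMap.flip_apply,
        LinearMap.llcomp_apply]
      refine sum_mem fun l _ => ?_
      rw [V.proj_of_mem l j v hv]
      split_ifs with h
      · subst h; exact W.proj_mem _ _
      · simp
    · intro f
      refine LinearMap.ext fun v => ?_
      have e : ∀ g : ZMod 2 → W, ∑ j, g j = g 0 + g 1 := fun g => Fin.sum_univ_two g
      simp only [LinearMap.sum_apply, LinearMap.comp_apply, LinearMap.flip_apply,
        LinearMap.llcomp_apply, LinearMap.add_apply, e, zero_add, add_zero]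
      rw [show (1 + 1 : ZMod 2) = 0 from rfl]
      calc _ = (W.proj 0 (f (V.proj 0 v)) + W.proj 1 (f (V.proj 0 v))) +
          (W.proj 0 (f (V.proj 1 v)) + W.proj 1 (f (V.proj 1 v))) := by abel
        _ = f v := by rw [proj_add_proj, proj_add_proj, ← map_add, proj_add_proj]
    · intro i f hf
      refine LinearMap.ext fun v => ?_
      simp only [LinearMap.sum_apply, LinearMap.comp_apply, LinearMap.flip_apply,
        LinearMap.llcomp_apply]
      refine Finset.sum_eq_zero fun j _ => ?_
      rw [W.proj_of_mem _ _ _ (hf j _ (V.proj_mem j v)), if_neg]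
      intro h
      exact add_one_ne i (add_right_cancel h)

theorem mem_ihom_gr {V W : SVec k} {i : ZMod 2} {f : V →ₗ[k] W} :
    f ∈ (ihom V W).gr i ↔ ∀ j, ∀ v ∈ V.gr j, f v ∈ W.gr (i + j) := Iff.rfl

/-- The identity map. -/
def iid (V : SVec k) : ihom V V := (LinearMap.id : V →ₗ[k] V)

/-- The composition of linear maps, as a bilinear map. -/
def icomp (U V W : SVec k) : ihom V W →ₗ[k] ihom U V →ₗ[k] ihom U W :=
  LinearMap.llcomp k U V W

theorem id_mem_ihom (V : SVec k) : iid V ∈ (ihom V V).gr 0 := by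
  intro j v hv
  rw [zero_add]; exact hv

theorem comp_mem_ihom {U V W : SVec k} {i j : ZMod 2} {f : ihom V W} {g : ihom U V}
    (hf : f ∈ (ihom V W).gr i) (hg : g ∈ (ihom U V).gr j) :
    icomp U V W f g ∈ (ihom U W).gr (i + j) := by
  intro l v hv
  rw [add_assoc]
  exact hf _ _ (hg _ _ hv)

/-- The direct sum of two super vector spaces. -/
def prod (V W : SVec k) : SVec k where
  carrier := V × W
  gr i := (V.gr i).prod (W.gr i)
  isCompl := by
    refine isCompl_of_proj (fun i => (V.gr i).prod (W.gr i)) (fun i => (V.proj i).prodMap (W.proj i)) ?_ ?_ ?_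
    · exact fun i x => ⟨V.proj_mem i _, W.proj_mem i _⟩
    · exact fun x => Prod.ext (V.proj_add_proj _) (W.proj_add_proj _)
    · rintro i ⟨v, w⟩ ⟨hv, hw⟩
      have := add_one_ne i
      refine Prod.ext ?_ ?_
      · change V.proj (i + 1) v = 0
        rw [V.proj_of_mem _ i v hv, if_neg this]
      · change W.proj (i + 1) w = 0
        rw [W.proj_of_mem _ i w hw, if_neg this]

theorem inl_mem_ihom (V W : SVec k) :
    (LinearMap.inl k V W : V →ₗ[k] V.prod W) ∈ (ihom V (V.prod W)).gr 0 := by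
  intro j v hv
  rw [zero_add]
  exact ⟨hv, zero_mem _⟩

theorem inr_mem_ihom (V W : SVec k) :
    (LinearMap.inr k V W : W →ₗ[k] V.prod W) ∈ (ihom W (V.prod W)).gr 0 := by
  intro j v hv
  rw [zero_add]
  exact ⟨zero_mem _, hv⟩

/-! ## Tensor powers and divided powers of super vector spaces -/

/-- The sign `(-1)^e`. -/
def ksgn (k : Type u) [Field k] (e : ZMod 2) : k := if e = 0 then 1 else -1

theorem ksgn_add (a b : ZMod 2) : ksgn k (a + b) = ksgn k a * ksgn k b := by
  have h : ∀ a : ZMod 2, a = 0 ∨ a = 1 := by decide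
  have e : (1 + 1 : ZMod 2) = 0 := rfl
  have e' : ¬ (1 : ZMod 2) = 0 := by decide
  rcases h a with rfl | rfl <;> rcases h b with rfl | rfl <;> simp [ksgn, e]

theorem ksgn_zero : ksgn k 0 = 1 := if_pos rfl

/-- The projection of `V^{⊗n}` onto `V_{ε 0} ⊗ ⋯ ⊗ V_{ε (n-1)}`. -/
noncomputable def parityProj (V : SVec k) {n : ℕ} (ε : Fin n → ZMod 2) :
    (⨂[k]^n V) →ₗ[k] (⨂[k]^n V) :=
  PiTensorProduct.map fun a => V.proj (ε a)

theorem parityProj_tprod (V : SVec k) {n : ℕ} (ε δ : Fin n → ZMod 2) (v : Fin n → V)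
    (hv : ∀ a, v a ∈ V.gr (δ a)) :
    V.parityProj ε (PiTensorProduct.tprod k v) =
      if ε = δ then PiTensorProduct.tprod k v else 0 := by
  rw [parityProj, PiTensorProduct.map_tprod]
  split_ifs with h
  · subst h
    congr 1
    funext a
    rw [V.proj_of_mem _ _ _ (hv a), if_pos rfl]
  · obtain ⟨a, ha⟩ := Function.ne_iff.1 h
    refine MultilinearMap.map_coord_zero _ a ?_
    rw [V.proj_of_mem _ _ _ (hv a), if_neg ha]

/-- The subspace of `V^{⊗n}` of parity `i`. -/
def tpowGr (V : SVec k) (n : ℕ) (i : ZMod 2) : Submodule k (⨂[k]^n V) :=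
  Submodule.span k {t | ∃ (ε : Fin n → ZMod 2) (v : Fin n → V),
    (∀ a, v a ∈ V.gr (ε a)) ∧ ∑ a, ε a = i ∧ PiTensorProduct.tprod k v = t}

theorem tpow_induction (V : SVec k) {n : ℕ} {p : (⨂[k]^n V) → Prop}
    (hom : ∀ (ε : Fin n → ZMod 2) (v : Fin n → V), (∀ a, v a ∈ V.gr (ε a)) →
      p (PiTensorProduct.tprod k v))
    (zero : p 0) (add : ∀ x y, p x → p y → p (x + y)) (smul : ∀ (c : k) x, p x → p (c • x))
    (x : ⨂[k]^n V) : p x := by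
  have key : ∀ v : Fin n → V, p (PiTensorProduct.tprod k v) := by
    intro v
    have : PiTensorProduct.tprod k v =
        ∑ ε : Fin n → ZMod 2, PiTensorProduct.tprod k fun a => V.proj (ε a) (v a) := by
      rw [← MultilinearMap.map_sum (PiTensorProduct.tprod k) fun a (i : ZMod 2) => V.proj i (v a)]
      congr 1
      funext a
      exact (V.sum_proj _).symm
    rw [this]
    exact Finset.sum_induction _ p add zero fun ε _ => hom ε _ fun a => V.proj_mem _ _
  induction x using PiTensorProduct.induction_on with
  | smul_tprod r v => exact smul r _ (key v)
  | add x y hx hy => exact add x y hx hy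

theorem tpow_ext (V : SVec k) {n : ℕ} {M : Type u} [AddCommGroup M] [Module k M]
    {f g : (⨂[k]^n V) →ₗ[k] M}
    (h : ∀ (ε : Fin n → ZMod 2) (v : Fin n → V), (∀ a, v a ∈ V.gr (ε a)) →
      f (PiTensorProduct.tprod k v) = g (PiTensorProduct.tprod k v)) : f = g := by
  refine LinearMap.ext fun x => ?_
  induction x using V.tpow_induction with
  | hom ε v hv => exact h ε v hv
  | zero => simp
  | add x y hx hy => rw [map_add, map_add, hx, hy]
  | smul c x hx => rw [map_smul, map_smul, hx]

/-- The projection of `V^{⊗n}` onto its part of parity `i`. -/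
noncomputable def tproj (V : SVec k) (n : ℕ) (i : ZMod 2) : (⨂[k]^n V) →ₗ[k] (⨂[k]^n V) :=
  ∑ ε : Fin n → ZMod 2, if ∑ a, ε a = i then V.parityProj ε else 0

theorem tproj_tprod (V : SVec k) {n : ℕ} (i : ZMod 2) (δ : Fin n → ZMod 2) (v : Fin n → V)
    (hv : ∀ a, v a ∈ V.gr (δ a)) :
    V.tproj n i (PiTensorProduct.tprod k v) =
      if ∑ a, δ a = i then PiTensorProduct.tprod k v else 0 := by
  rw [tproj, LinearMap.sum_apply, Finset.sum_eq_single δ]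
  · split_ifs with h
    · rw [parityProj_tprod V δ δ v hv, if_pos rfl]
    · rfl
  · intro ε _ hε
    split_ifs
    · rw [parityProj_tprod V ε δ v hv, if_neg hε]
    · rfl
  · simp

theorem tproj_mem (V : SVec k) {n : ℕ} (i : ZMod 2) (x : ⨂[k]^n V) :
    V.tproj n i x ∈ V.tpowGr n i := by
  induction x using V.tpow_induction with
  | hom ε v hv =>
    rw [tproj_tprod V i ε v hv]
    split_ifs with h
    · exact Submodule.subset_span ⟨ε, v, hv, h, rfl⟩
    · exact zero_mem _
  | zero => rw [map_zero]; exact zero_mem _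
  | add x y hx hy => rw [map_add]; exact add_mem hx hy
  | smul c x hx => rw [map_smul]; exact Submodule.smul_mem _ c hx

theorem tproj_add_tproj (V : SVec k) {n : ℕ} (x : ⨂[k]^n V) :
    V.tproj n 0 x + V.tproj n 1 x = x := by
  have : V.tproj n 0 + V.tproj n 1 = LinearMap.id := by
    refine V.tpow_ext fun ε v hv => ?_
    rw [LinearMap.add_apply, tproj_tprod V 0 ε v hv, tproj_tprod V 1 ε v hv]
    have h : ∀ a : ZMod 2, a = 0 ∨ a = 1 := by decide
    rcases h (∑ a, ε a) with h | h <;> simp [h]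
  exact LinearMap.congr_fun this x

theorem tproj_of_mem (V : SVec k) {n : ℕ} (i : ZMod 2) (x : ⨂[k]^n V)
    (hx : x ∈ V.tpowGr n i) : V.tproj n (i + 1) x = 0 := by
  induction hx using Submodule.span_induction with
  | mem x h =>
    obtain ⟨ε, v, hv, hi, rfl⟩ := h
    rw [tproj_tprod V _ ε v hv, if_neg]
    rw [hi]; exact (add_one_ne i).symm
  | zero => simp
  | add x y _ _ hx hy => rw [map_add, hx, hy, add_zero]
  | smul c x _ hx => rw [map_smul, hx, smul_zero]

/-- The exponent of the Koszul sign by which `σ` permutes homogeneous vectors of parities `ε`: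
the sum of `ε a * ε b` over the inversions of `σ`. -/
def permExp {n : ℕ} (σ : Equiv.Perm (Fin n)) (ε : Fin n → ZMod 2) : ZMod 2 :=
  ∑ a, ∑ b, if a < b ∧ σ b < σ a then ε a * ε b else 0

/-- The signed action of the permutation `σ` on `V^{⊗n}`; on homogeneous `v_a ∈ V_{ε a}`,
`v_0 ⊗ ⋯ ⊗ v_{n-1}` is sent to `±` the tensor with `v_a` in position `σ a`. For `σ = (a, a+1)` the
sign is `(-1)^{ε a * ε (a+1)}`. -/
noncomputable def permAct (V : SVec k) {n : ℕ} (σ : Equiv.Perm (Fin n)) :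
    (⨂[k]^n V) →ₗ[k] (⨂[k]^n V) :=
  ∑ ε : Fin n → ZMod 2, ksgn k (permExp σ ε) •
    ((PiTensorProduct.reindex k (fun _ => V.carrier) σ).toLinearMap ∘ₗ V.parityProj ε)

theorem permAct_tprod (V : SVec k) {n : ℕ} (σ : Equiv.Perm (Fin n)) (δ : Fin n → ZMod 2)
    (v : Fin n → V) (hv : ∀ a, v a ∈ V.gr (δ a)) :
    V.permAct σ (PiTensorProduct.tprod k v) =
      ksgn k (permExp σ δ) • PiTensorProduct.tprod k fun a => v (σ.symm a) := by
  rw [permAct, LinearMap.sum_apply, Finset.sum_eq_single δ]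
  · rw [LinearMap.smul_apply, LinearMap.comp_apply, parityProj_tprod V δ δ v hv, if_pos rfl]
    congr 1
    exact PiTensorProduct.reindex_tprod σ v
  · intro ε _ hε
    rw [LinearMap.smul_apply, LinearMap.comp_apply, parityProj_tprod V ε δ v hv, if_neg hε,
      map_zero, smul_zero]
  · simp

/-- The space `Γ^n V` of invariants of `V^{⊗n}` under the signed action of the symmetric group. -/
noncomputable def gammaSub (V : SVec k) (n : ℕ) : Submodule k (⨂[k]^n V) where
  carrier := {x | ∀ σ : Equiv.Perm (Fin n), V.permAct σ x = x}
  add_mem' := fun hx hy σ => by rw [map_add, hx σ, hy σ]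
  zero_mem' := fun σ => map_zero _
  smul_mem' := fun c x hx σ => by rw [map_smul, hx σ]

theorem permAct_tproj (V : SVec k) {n : ℕ} (σ : Equiv.Perm (Fin n)) (i : ZMod 2)
    (x : ⨂[k]^n V) : V.permAct σ (V.tproj n i x) = V.tproj n i (V.permAct σ x) := by
  have : V.permAct σ ∘ₗ V.tproj n i = V.tproj n i ∘ₗ V.permAct σ := by
    refine V.tpow_ext fun ε v hv => ?_
    rw [LinearMap.comp_apply, LinearMap.comp_apply, tproj_tprod V i ε v hv,
      permAct_tprod V σ ε v hv, map_smul,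
      tproj_tprod V i (fun a => ε (σ.symm a)) _ (fun a => hv _), Equiv.sum_comp σ.symm ε]
    split_ifs
    · exact permAct_tprod V σ ε v hv
    · rw [map_zero, smul_zero]
  exact LinearMap.congr_fun this x

/-- The super vector space `Γ^n V`, graded by the total parity. -/
noncomputable def gamma (V : SVec k) (n : ℕ) : SVec k where
  carrier := V.gammaSub n
  gr i := (V.tpowGr n i).comap (V.gammaSub n).subtype
  isCompl := by
    refine isCompl_of_proj (fun i => (V.tpowGr n i).comap (V.gammaSub n).subtype)
      (fun i => (V.tproj n i).restrict (p := V.gammaSub n)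
      (q := V.gammaSub n) fun x hx σ => ?_) ?_ ?_ ?_
    · rw [permAct_tproj, hx σ]
    · intro i x
      exact V.tproj_mem i x.1
    · intro x
      exact Subtype.ext (V.tproj_add_tproj x.1)
    · intro i x hx
      exact Subtype.ext (V.tproj_of_mem i x.1 hx)

theorem tprod_mem_gammaSub (V : SVec k) (n : ℕ) (v : V) (hv : v ∈ V.gr 0) :
    PiTensorProduct.tprod k (fun _ : Fin n => v) ∈ V.gammaSub n := by
  intro σ
  rw [permAct_tprod V σ (fun _ => 0) _ (fun _ => hv)]
  simp [permExp, ksgn_zero]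

theorem tprod_mem_tpowGr (V : SVec k) (n : ℕ) (v : V) (hv : v ∈ V.gr 0) :
    PiTensorProduct.tprod k (fun _ : Fin n => v) ∈ V.tpowGr n 0 :=
  Submodule.subset_span ⟨fun _ => 0, _, fun _ => hv, by simp, rfl⟩

/-! ## Composition of tensors of linear maps, with Koszul signs -/

/-- The exponent of the Koszul sign of the interchange
`(f_0 ⊗ ⋯ ⊗ f_{n-1}) ∘ (g_0 ⊗ ⋯ ⊗ g_{n-1}) = ± f_0 g_0 ⊗ ⋯ ⊗ f_{n-1} g_{n-1}`,
where `f_a` has parity `ε a` and `g_a` has parity `δ a`. -/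
def compExp {n : ℕ} (ε δ : Fin n → ZMod 2) : ZMod 2 :=
  ∑ a, ∑ b, if b < a then ε a * δ b else 0

theorem compExp_add_left {n : ℕ} (ε ε' δ : Fin n → ZMod 2) :
    compExp (fun a => ε a + ε' a) δ = compExp ε δ + compExp ε' δ := by
  simp only [compExp, ← Finset.sum_add_distrib]
  refine Finset.sum_congr rfl fun a _ => Finset.sum_congr rfl fun b _ => ?_
  split_ifs <;> ring

theorem compExp_add_right {n : ℕ} (ε δ δ' : Fin n → ZMod 2) :
    compExp ε (fun a => δ a + δ' a) = compExp ε δ + compExp ε δ' := by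
  simp only [compExp, ← Finset.sum_add_distrib]
  refine Finset.sum_congr rfl fun a _ => Finset.sum_congr rfl fun b _ => ?_
  split_ifs <;> ring

theorem permExp_add {n : ℕ} (σ : Equiv.Perm (Fin n)) (ε δ : Fin n → ZMod 2) :
    compExp ε δ + permExp σ (fun a => ε a + δ a) =
      permExp σ ε + permExp σ δ + compExp (fun a => ε (σ.symm a)) (fun a => δ (σ.symm a)) := by
  have h1 : compExp (fun a => ε (σ.symm a)) (fun a => δ (σ.symm a)) =
      ∑ a, ∑ b, if σ b < σ a then ε a * δ b else 0 := by
    rw [compExp, ← Equiv.sum_comp σ]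
    refine Finset.sum_congr rfl fun a _ => ?_
    rw [← Equiv.sum_comp σ]
    simp
  have h2 : permExp σ (fun a => ε a + δ a) = permExp σ ε + permExp σ δ +
      ((∑ a, ∑ b, if a < b ∧ σ b < σ a then ε a * δ b else 0) +
        ∑ a, ∑ b, if b < a ∧ σ a < σ b then ε a * δ b else 0) := by
    have h3 : (∑ a, ∑ b, if b < a ∧ σ a < σ b then ε a * δ b else 0) =
        ∑ a, ∑ b, if a < b ∧ σ b < σ a then ε b * δ a else 0 := Finset.sum_comm
    rw [h3]
    simp only [permExp, ← Finset.sum_add_distrib]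
    refine Finset.sum_congr rfl fun a _ => Finset.sum_congr rfl fun b _ => ?_
    split_ifs <;> ring
  rw [h1, h2]
  have h4 : compExp ε δ + ((∑ a, ∑ b, if a < b ∧ σ b < σ a then ε a * δ b else 0) +
        ∑ a, ∑ b, if b < a ∧ σ a < σ b then ε a * δ b else 0) =
      ∑ a, ∑ b, if σ b < σ a then ε a * δ b else 0 := by
    simp only [compExp, ← Finset.sum_add_distrib]
    refine Finset.sum_congr rfl fun a _ => Finset.sum_congr rfl fun b _ => ?_
    have two : ∀ x : ZMod 2, x + x = 0 := by decide
    rcases lt_trichotomy a b with h | rfl | h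
    · simp [h, h.not_gt]
    · simp
    · rcases lt_trichotomy (σ a) (σ b) with h' | h' | h'
      · simp [h, h.not_gt, h', h'.not_gt, two]
      · exact absurd (σ.injective h') h.ne'
      · simp [h, h.not_gt, h', h'.not_gt]
  rw [← h4]; ring

/-- The composition `Hom(V,W)^{⊗n} ⊗ Hom(U,V)^{⊗n} → Hom(U,W)^{⊗n}`, with Koszul signs. It
corresponds to the composition of linear maps `U^{⊗n} → V^{⊗n} → W^{⊗n}`, where
`(f_0 ⊗ ⋯ ⊗ f_{n-1})(v_0 ⊗ ⋯ ⊗ v_{n-1}) = ± f_0(v_0) ⊗ ⋯ ⊗ f_{n-1}(v_{n-1})` with the analogous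
sign. -/
noncomputable def tcomp (U V W : SVec k) (n : ℕ) :
    (⨂[k]^n (ihom V W)) →ₗ[k] (⨂[k]^n (ihom U V)) →ₗ[k] (⨂[k]^n (ihom U W)) :=
  ∑ ε : Fin n → ZMod 2, ∑ δ : Fin n → ZMod 2, ksgn k (compExp ε δ) •
    (PiTensorProduct.map₂ (R := k) (s := fun _ : Fin n => (ihom V W).carrier)
      (t := fun _ : Fin n => (ihom U V).carrier) (t' := fun _ : Fin n => (ihom U W).carrier)
      fun _ => icomp U V W).compl₁₂
      ((ihom V W).parityProj ε) ((ihom U V).parityProj δ)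

theorem tcomp_tprod {U V W : SVec k} {n : ℕ} (ε δ : Fin n → ZMod 2)
    (f : Fin n → ihom V W) (g : Fin n → ihom U V) (hf : ∀ a, f a ∈ (ihom V W).gr (ε a))
    (hg : ∀ a, g a ∈ (ihom U V).gr (δ a)) :
    tcomp U V W n (PiTensorProduct.tprod k f) (PiTensorProduct.tprod k g) =
      ksgn k (compExp ε δ) •
        PiTensorProduct.tprod k fun a => icomp U V W (f a) (g a) := by
  simp only [tcomp, LinearMap.sum_apply, LinearMap.smul_apply, LinearMap.compl₁₂_apply]
  rw [Finset.sum_eq_single ε, Finset.sum_eq_single δ]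
  · rw [parityProj_tprod _ ε ε f hf, parityProj_tprod _ δ δ g hg, if_pos rfl, if_pos rfl]
    congr 1
    exact PiTensorProduct.map₂_tprod_tprod _ _ _
  · intro δ' _ h
    rw [parityProj_tprod _ δ' δ g hg, if_neg h, map_zero, smul_zero]
  · simp
  · intro ε' _ h
    refine Finset.sum_eq_zero fun δ' _ => ?_
    rw [parityProj_tprod _ ε' ε f hf, if_neg h, map_zero, LinearMap.zero_apply, smul_zero]
  · simp

theorem permAct_tcomp {U V W : SVec k} {n : ℕ} (σ : Equiv.Perm (Fin n))
    (x : ⨂[k]^n (ihom V W)) (y : ⨂[k]^n (ihom U V)) :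
    (ihom U W).permAct σ (tcomp U V W n x y) =
      tcomp U V W n ((ihom V W).permAct σ x) ((ihom U V).permAct σ y) := by
  induction x using (ihom V W).tpow_induction with
  | zero => simp
  | add x x' hx hx' => simp only [map_add, LinearMap.add_apply, hx, hx']
  | smul c x hx => simp only [map_smul, LinearMap.smul_apply, hx]
  | hom ε f hf =>
    induction y using (ihom U V).tpow_induction with
    | zero => simp
    | add y y' hy hy' => simp only [map_add, hy, hy']
    | smul c y hy => simp only [map_smul, hy]
    | hom δ g hg =>
      rw [tcomp_tprod ε δ f g hf hg, map_smul,
        permAct_tprod _ σ (fun a => ε a + δ a) _ (fun a => comp_mem_ihom (hf a) (hg a)),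
        permAct_tprod _ σ ε f hf, permAct_tprod _ σ δ g hg, map_smul, map_smul,
        LinearMap.smul_apply,
        tcomp_tprod (fun a => ε (σ.symm a)) (fun a => δ (σ.symm a)) _ _ (fun a => hf _)
          (fun a => hg _),
        smul_smul, smul_smul, smul_smul, ← ksgn_add, ← ksgn_add, ← ksgn_add, permExp_add]
      congr 2
      ring

theorem tcomp_mem_gammaSub {U V W : SVec k} {n : ℕ} {x : ⨂[k]^n (ihom V W)}
    {y : ⨂[k]^n (ihom U V)} (hx : x ∈ (ihom V W).gammaSub n) (hy : y ∈ (ihom U V).gammaSub n) :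
    tcomp U V W n x y ∈ (ihom U W).gammaSub n := fun σ => by
  rw [permAct_tcomp, hx σ, hy σ]

theorem tcomp_mem_tpowGr {U V W : SVec k} {n : ℕ} {i j : ZMod 2} {x : ⨂[k]^n (ihom V W)}
    {y : ⨂[k]^n (ihom U V)} (hx : x ∈ (ihom V W).tpowGr n i) (hy : y ∈ (ihom U V).tpowGr n j) :
    tcomp U V W n x y ∈ (ihom U W).tpowGr n (i + j) := by
  induction hx using Submodule.span_induction with
  | zero => simp
  | add x x' _ _ hx hx' => rw [map_add, LinearMap.add_apply]; exact add_mem hx hx'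
  | smul c x _ hx => rw [map_smul, LinearMap.smul_apply]; exact Submodule.smul_mem _ c hx
  | mem x h =>
    obtain ⟨ε, f, hf, hi, rfl⟩ := h
    induction hy using Submodule.span_induction with
    | zero => simp
    | add y y' _ _ hy hy' => rw [map_add]; exact add_mem hy hy'
    | smul c y _ hy => rw [map_smul]; exact Submodule.smul_mem _ c hy
    | mem y h =>
      obtain ⟨δ, g, hg, hj, rfl⟩ := h
      rw [tcomp_tprod ε δ f g hf hg]
      refine Submodule.smul_mem _ _ (Submodule.subset_span
        ⟨fun a => ε a + δ a, _, fun a => comp_mem_ihom (hf a) (hg a), ?_, rfl⟩)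
      rw [Finset.sum_add_distrib, hi, hj]

theorem tcomp_assoc {T U V W : SVec k} {n : ℕ} (x : ⨂[k]^n (ihom V W))
    (y : ⨂[k]^n (ihom U V)) (z : ⨂[k]^n (ihom T U)) :
    tcomp T U W n (tcomp U V W n x y) z = tcomp T V W n x (tcomp T U V n y z) := by
  induction x using (ihom V W).tpow_induction with
  | zero => simp
  | add x x' hx hx' => simp only [map_add, LinearMap.add_apply, hx, hx']
  | smul c x hx => simp only [map_smul, LinearMap.smul_apply, hx]
  | hom ε f hf =>
    induction y using (ihom U V).tpow_induction with
    | zero => simp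
    | add y y' hy hy' => simp only [map_add, LinearMap.add_apply, hy, hy']
    | smul c y hy => simp only [map_smul, LinearMap.smul_apply, hy]
    | hom δ g hg =>
      induction z using (ihom T U).tpow_induction with
      | zero => simp
      | add z z' hz hz' => simp only [map_add, hz, hz']
      | smul c z hz => simp only [map_smul, hz]
      | hom η h hh =>
        rw [tcomp_tprod ε δ f g hf hg, tcomp_tprod δ η g h hg hh, map_smul, map_smul,
          LinearMap.smul_apply,
          tcomp_tprod (fun a => ε a + δ a) η _ h (fun a => comp_mem_ihom (hf a) (hg a)) hh,
          tcomp_tprod ε (fun a => δ a + η a) f _ hf (fun a => comp_mem_ihom (hg a) (hh a)),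
          smul_smul, smul_smul, ← ksgn_add, ← ksgn_add, compExp_add_left, compExp_add_right]
        congr 2
        ring

theorem compExp_zero_left {n : ℕ} (δ : Fin n → ZMod 2) : compExp (fun _ => 0) δ = 0 := by
  simp [compExp]

theorem compExp_zero_right {n : ℕ} (δ : Fin n → ZMod 2) : compExp δ (fun _ => 0) = 0 := by
  simp [compExp]

theorem tcomp_id_left {U V : SVec k} {n : ℕ} (y : ⨂[k]^n (ihom U V)) :
    tcomp U V V n (PiTensorProduct.tprod k fun _ => iid V) y = y := by
  induction y using (ihom U V).tpow_induction with
  | zero => simp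
  | add y y' hy hy' => simp only [map_add, hy, hy']
  | smul c y hy => simp only [map_smul, hy]
  | hom δ g hg =>
    rw [tcomp_tprod (fun _ => 0) δ _ g (fun _ => id_mem_ihom V) hg, compExp_zero_left, ksgn_zero,
      one_smul]
    rfl

theorem tcomp_id_right {U V : SVec k} {n : ℕ} (y : ⨂[k]^n (ihom U V)) :
    tcomp U U V n y (PiTensorProduct.tprod k fun _ => iid U) = y := by
  induction y using (ihom U V).tpow_induction with
  | zero => simp
  | add y y' hy hy' => simp only [map_add, LinearMap.add_apply, hy, hy']
  | smul c y hy => simp only [map_smul, LinearMap.smul_apply, hy]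
  | hom δ g hg =>
    rw [tcomp_tprod δ (fun _ => 0) g _ hg (fun _ => id_mem_ihom U), compExp_zero_right, ksgn_zero,
      one_smul]
    rfl

end SVec

/-! ## Superlinear categories and functors -/

/-- A superlinear category: a `k`-linear category enriched over super vector spaces. -/
class Superlinear (k : Type u) [Field k] (C : Type*) [Category C] [Preadditive C]
    [Linear k C] where
  /-- the even (`i = 0`) and odd (`i = 1`) morphisms -/
  homGr (X Y : C) (i : ZMod 2) : Submodule k (X ⟶ Y)
  isCompl_homGr (X Y : C) : IsCompl (homGr X Y 0) (homGr X Y 1)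
  id_mem (X : C) : 𝟙 X ∈ homGr X X 0
  comp_mem {X Y Z : C} {i j : ZMod 2} {f : X ⟶ Y} {g : Y ⟶ Z} :
    f ∈ homGr X Y i → g ∈ homGr Y Z j → f ≫ g ∈ homGr X Z (i + j)

/-- An even superlinear functor: the maps `Hom(X,Y) → Hom(F X,F Y)` are linear and even. -/
structure IsSuperlinear (k : Type u) [Field k] {C D : Type*} [Category C] [Preadditive C]
    [Linear k C] [Superlinear k C] [Category D] [Preadditive D] [Linear k D] [Superlinear k D]
    (F : C ⥤ D) : Prop where
  map_add {X Y : C} (f g : X ⟶ Y) : F.map (f + g) = F.map f + F.map g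
  map_smul {X Y : C} (c : k) (f : X ⟶ Y) : F.map (c • f) = c • F.map f
  map_mem {X Y : C} (i : ZMod 2) (f : X ⟶ Y) : f ∈ Superlinear.homGr (k := k) X Y i →
    F.map f ∈ Superlinear.homGr (k := k) (F.obj X) (F.obj Y) i

/-- The category `C_ev` with the objects of `C` and its even morphisms. -/
structure Ev (k : Type u) [Field k] (C : Type*) [Category C] [Preadditive C] [Linear k C]
    [Superlinear k C] where
  obj : C

namespace Ev

variable {k : Type u} [Field k] {C : Type*} [Category C] [Preadditive C] [Linear k C]
  [Superlinear k C]

instance : Category (Ev k C) where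
  Hom X Y := Superlinear.homGr (k := k) X.obj Y.obj 0
  id X := ⟨𝟙 X.obj, Superlinear.id_mem X.obj⟩
  comp f g := ⟨f.1 ≫ g.1, Superlinear.comp_mem (i := 0) (j := 0) f.2 g.2⟩
  id_comp f := Subtype.ext (Category.id_comp f.1)
  comp_id f := Subtype.ext (Category.comp_id f.1)
  assoc f g h := Subtype.ext (Category.assoc f.1 g.1 h.1)

instance : Preadditive (Ev k C) where
  homGroup X Y := inferInstanceAs (AddCommGroup (Superlinear.homGr (k := k) X.obj Y.obj 0))
  add_comp _ _ _ f g h := Subtype.ext (Preadditive.add_comp _ _ _ f.1 g.1 h.1)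
  comp_add _ _ _ f g h := Subtype.ext (Preadditive.comp_add _ _ _ f.1 g.1 h.1)

instance : Linear k (Ev k C) where
  homModule X Y := inferInstanceAs (Module k (Superlinear.homGr (k := k) X.obj Y.obj 0))
  smul_comp _ _ _ c f g := Subtype.ext (Linear.smul_comp _ _ _ c f.1 g.1)
  comp_smul _ _ _ f c g := Subtype.ext (Linear.comp_smul _ _ _ f.1 c g.1)

/-- All morphisms of `C_ev` are even. -/
instance : Superlinear k (Ev k C) where
  homGr _ _ i := if i = 0 then ⊤ else ⊥
  isCompl_homGr _ _ := by simpa using isCompl_top_bot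
  id_mem _ := by simp
  comp_mem {X Y Z i j f g} hf hg := by
    have h : ∀ a : ZMod 2, a = 0 ∨ a = 1 := by decide
    have h1 : ¬ (1 : ZMod 2) = 0 := by decide
    rcases h i with rfl | rfl <;> rcases h j with rfl | rfl
    · simp
    · have : g = 0 := by simpa using hg
      rw [this, Limits.comp_zero]; exact zero_mem _
    · have : f = 0 := by simpa using hf
      rw [this, Limits.zero_comp]; exact zero_mem _
    · have : f = 0 := by simpa using hf
      rw [this, Limits.zero_comp]; exact zero_mem _

/-- The inclusion functor `C_ev ⥤ C`. -/
def incl (k : Type u) [Field k] (C : Type*) [Category C] [Preadditive C] [Linear k C]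
    [Superlinear k C] : Ev k C ⥤ C where
  obj X := X.obj
  map f := f.1

end Ev

namespace SVec

variable {k : Type u} [Field k]

/-- The category of super vector spaces and all linear maps. -/
instance : Category (SVec k) where
  Hom V W := ihom V W
  id V := iid V
  comp {U V W} f g := icomp U V W g f
  id_comp _ := rfl
  comp_id _ := rfl
  assoc _ _ _ := rfl

instance : Preadditive (SVec k) where
  homGroup V W := inferInstanceAs (AddCommGroup (ihom V W))
  add_comp U V W f g h := (icomp U V W h).map_add f g
  comp_add U V W f g h := LinearMap.map_add₂ (icomp U V W) (g : ihom V W) (h : ihom V W) f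

instance : Linear k (SVec k) where
  homModule V W := inferInstanceAs (Module k (ihom V W))
  smul_comp U V W c f g := (icomp U V W g).map_smul c f
  comp_smul U V W f c g := LinearMap.map_smul₂ (icomp U V W) c (g : ihom V W) f

instance : Superlinear k (SVec k) where
  homGr V W := (ihom V W).gr
  isCompl_homGr V W := (ihom V W).isCompl
  id_mem V := id_mem_ihom V
  comp_mem {U V W i j f g} hf hg := by
    rw [add_comm]
    exact comp_mem_ihom hg hf

/-- The linear map underlying a morphism of super vector spaces. -/
def toLin {V W : SVec k} (f : V ⟶ W) : V →ₗ[k] W := f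

end SVec

/-! ## Strict polynomial superfunctors -/

/-- A finite dimensional super vector space. -/
structure FinSVec (k : Type u) [Field k] where
  toSVec : SVec k
  finite : FiniteDimensional k toSVec

/-- The objects of the category `Γ^n 𝐕`: finite dimensional super vector spaces. -/
structure GammaSV (k : Type u) [Field k] (n : ℕ) where
  base : FinSVec k

namespace GammaSV

variable {k : Type u} [Field k] {n : ℕ}

/-- The super vector space `Γ^n Hom(V,W)` of morphisms from `V` to `W` in `Γ^n 𝐕`. -/
noncomputable abbrev homSVec (n : ℕ) (V W : FinSVec k) : SVec k :=
  (SVec.ihom V.toSVec W.toSVec).gamma n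

noncomputable instance : Category (GammaSV k n) where
  Hom V W := homSVec n V.base W.base
  id V := ⟨PiTensorProduct.tprod k fun _ => SVec.iid V.base.toSVec,
    SVec.tprod_mem_gammaSub _ n _ (SVec.id_mem_ihom _)⟩
  comp f g := ⟨SVec.tcomp _ _ _ n g.1 f.1, SVec.tcomp_mem_gammaSub g.2 f.2⟩
  id_comp f := Subtype.ext (SVec.tcomp_id_right f.1)
  comp_id f := Subtype.ext (SVec.tcomp_id_left f.1)
  assoc f g h := Subtype.ext (SVec.tcomp_assoc h.1 g.1 f.1).symm

noncomputable instance : Preadditive (GammaSV k n) where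
  homGroup V W := inferInstanceAs (AddCommGroup (homSVec n V.base W.base))
  add_comp _ _ _ f g h := Subtype.ext (map_add (SVec.tcomp _ _ _ n h.1) f.1 g.1)
  comp_add _ _ _ f g h := Subtype.ext (LinearMap.map_add₂ (SVec.tcomp _ _ _ n) g.1 h.1 f.1)

noncomputable instance : Linear k (GammaSV k n) where
  homModule V W := inferInstanceAs (Module k (homSVec n V.base W.base))
  smul_comp _ _ _ c f g := Subtype.ext (map_smul (SVec.tcomp _ _ _ n g.1) c f.1)
  comp_smul _ _ _ f c g := Subtype.ext (LinearMap.map_smul₂ (SVec.tcomp _ _ _ n) c g.1 f.1)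

noncomputable instance : Superlinear k (GammaSV k n) where
  homGr V W := (homSVec n V.base W.base).gr
  isCompl_homGr V W := (homSVec n V.base W.base).isCompl
  id_mem V := SVec.tprod_mem_tpowGr _ n _ (SVec.id_mem_ihom V.base.toSVec)
  comp_mem {U V W i j f g} hf hg := by
    rw [add_comm]
    exact SVec.tcomp_mem_tpowGr (x := g.1) (y := f.1) hg hf

/-- The direct sum of two finite dimensional super vector spaces. -/
def prod (V W : GammaSV k n) : GammaSV k n where
  base :=
    { toSVec := V.base.toSVec.prod W.base.toSVec
      finite := by
        have := V.base.finite
        have := W.base.finite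
        exact inferInstanceAs (FiniteDimensional k (V.base.toSVec × W.base.toSVec)) }

/-- The morphism `i ⊗ ⋯ ⊗ i` given by the first inclusion `i : V → V ⊕ W`. -/
noncomputable def inl (V W : GammaSV k n) : V ⟶ V.prod W :=
  ⟨PiTensorProduct.tprod k fun _ => LinearMap.inl k V.base.toSVec W.base.toSVec,
    SVec.tprod_mem_gammaSub _ n _ (SVec.inl_mem_ihom _ _)⟩

/-- The morphism `i ⊗ ⋯ ⊗ i` given by the second inclusion `i : W → V ⊕ W`. -/
noncomputable def inr (V W : GammaSV k n) : W ⟶ V.prod W :=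
  ⟨PiTensorProduct.tprod k fun _ => LinearMap.inr k V.base.toSVec W.base.toSVec,
    SVec.tprod_mem_gammaSub _ n _ (SVec.inr_mem_ihom _ _)⟩

end GammaSV

/-- A homogeneous strict polynomial superfunctor of degree `n`, with values that may be infinite
dimensional: an even superlinear functor `Γ^n 𝐕 ⥤ svec`. -/
structure Superfunctor (k : Type u) [Field k] (n : ℕ) where
  functor : GammaSV k n ⥤ SVec k
  isSuperlinear : IsSuperlinear k functor

namespace Superfunctor

variable {k : Type u} [Field k] {n : ℕ}

/-- `A` is additive if the inclusions induce an isomorphism `A(V) ⊕ A(W) ≃ A(V ⊕ W)`. -/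
def IsAdditive (A : Superfunctor k n) : Prop :=
  ∀ V W : GammaSV k n, Function.Bijective
    fun x : (A.functor.obj V).carrier × (A.functor.obj W).carrier =>
      SVec.toLin (A.functor.map (GammaSV.inl V W)) x.1 +
        SVec.toLin (A.functor.map (GammaSV.inr V W)) x.2

/-- `A` has finite dimensional values. -/
def HasFiniteValues (A : Superfunctor k n) : Prop :=
  ∀ V : GammaSV k n, FiniteDimensional k (A.functor.obj V)

/-- The linear map `Γ^n Hom(V,W) → Hom(A(V),A(W))`. -/
def mapLin (A : Superfunctor k n) (V W : FinSVec k) :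
    (GammaSV.homSVec n V W).carrier →ₗ[k]
      (SVec.ihom (A.functor.obj ⟨V⟩) (A.functor.obj ⟨W⟩)).carrier where
  toFun f := A.functor.map (X := ⟨V⟩) (Y := ⟨W⟩) f
  map_add' f g := A.isSuperlinear.map_add (X := ⟨V⟩) (Y := ⟨W⟩) f g
  map_smul' c f := A.isSuperlinear.map_smul (X := ⟨V⟩) (Y := ⟨W⟩) c f

/-- The value of `A` at `V`, as a finite dimensional super vector space. -/
def fobj (A : Superfunctor k n) (hA : A.HasFiniteValues) (V : FinSVec k) : FinSVec k :=
  ⟨A.functor.obj ⟨V⟩, hA ⟨V⟩⟩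

end Superfunctor

/-- The category `(𝐏_n)_ev`: homogeneous strict polynomial superfunctors of degree `n` with finite
dimensional values, and even natural transformations. -/
structure PolySuperEv (k : Type u) [Field k] (n : ℕ) extends Superfunctor k n where
  finite : toSuperfunctor.HasFiniteValues

namespace PolySuperEv

variable {k : Type u} [Field k] {n : ℕ}

/-- An even natural transformation. As it is even, no sign enters in the naturality. -/
@[ext]
structure Hom (F G : PolySuperEv k n) where
  nat : F.functor ⟶ G.functor
  even : ∀ V, nat.app V ∈ Superlinear.homGr (k := k) (F.functor.obj V) (G.functor.obj V) 0

noncomputable instance : Category (PolySuperEv k n) where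
  Hom F G := Hom F G
  id F := ⟨𝟙 F.functor, fun _ => Superlinear.id_mem _⟩
  comp f g := ⟨f.nat ≫ g.nat,
    fun V => Superlinear.comp_mem (i := 0) (j := 0) (f.even V) (g.even V)⟩
  id_comp _ := Hom.ext (Category.id_comp _)
  comp_id _ := Hom.ext (Category.comp_id _)
  assoc _ _ _ := Hom.ext (Category.assoc _ _ _)

end PolySuperEv

/-! ## Classical strict polynomial functors -/

/-- The space of invariants of `M^{⊗d}` under the (unsigned) permutations of the factors. -/
noncomputable def symSub (k : Type u) [Field k] (M : Type u) [AddCommGroup M] [Module k M]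
    (d : ℕ) : Submodule k (⨂[k]^d M) where
  carrier := {x | ∀ σ : Equiv.Perm (Fin d), PiTensorProduct.reindex k (fun _ => M) σ x = x}
  add_mem' := fun hx hy σ => by rw [map_add, hx σ, hy σ]
  zero_mem' := fun σ => map_zero _
  smul_mem' := fun c x hx σ => by rw [map_smul, hx σ]

/-- The objects of the category `Γ^d 𝒱`: finite dimensional vector spaces. -/
structure GammaV (k : Type u) [Field k] (d : ℕ) where
  carrier : Type u
  [addCommGroup : AddCommGroup carrier]
  [module : Module k carrier]
  finite : FiniteDimensional k carrier

attribute [instance] GammaV.addCommGroup GammaV.module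

namespace GammaV

variable {k : Type u} [Field k] {d : ℕ}

/-- The composition `(f_0 ⊗ ⋯ ⊗ f_{d-1}) ∘ (g_0 ⊗ ⋯ ⊗ g_{d-1}) = f_0 g_0 ⊗ ⋯ ⊗ f_{d-1} g_{d-1}`
of tensors of linear maps. -/
noncomputable def tcomp (k : Type u) [Field k] (d : ℕ) (L M N : Type u) [AddCommGroup L]
    [Module k L] [AddCommGroup M] [Module k M] [AddCommGroup N] [Module k N] :
    (⨂[k]^d (M →ₗ[k] N)) →ₗ[k] (⨂[k]^d (L →ₗ[k] M)) →ₗ[k] (⨂[k]^d (L →ₗ[k] N)) :=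
  PiTensorProduct.map₂ fun _ => LinearMap.llcomp k L M N

section

variable {K L M N : Type u} [AddCommGroup K] [Module k K] [AddCommGroup L]
  [Module k L] [AddCommGroup M] [Module k M] [AddCommGroup N] [Module k N]

theorem tcomp_tprod (f : Fin d → (M →ₗ[k] N)) (g : Fin d → (L →ₗ[k] M)) :
    tcomp k d L M N (PiTensorProduct.tprod k f) (PiTensorProduct.tprod k g) =
      PiTensorProduct.tprod k fun a => f a ∘ₗ g a :=
  PiTensorProduct.map₂_tprod_tprod _ _ _

theorem tcomp_assoc (x : ⨂[k]^d (M →ₗ[k] N)) (y : ⨂[k]^d (L →ₗ[k] M)) (z : ⨂[k]^d (K →ₗ[k] L)) :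
    tcomp k d K L N (tcomp k d L M N x y) z = tcomp k d K M N x (tcomp k d K L M y z) := by
  induction x using PiTensorProduct.induction_on with
  | add x x' hx hx' => simp only [map_add, LinearMap.add_apply, hx, hx']
  | smul_tprod r f =>
    simp only [map_smul, LinearMap.smul_apply]
    congr 1
    induction y using PiTensorProduct.induction_on with
    | add y y' hy hy' => simp only [map_add, LinearMap.add_apply, hy, hy']
    | smul_tprod s g =>
      simp only [map_smul, LinearMap.smul_apply]
      congr 1
      induction z using PiTensorProduct.induction_on with
      | add z z' hz hz' => simp only [map_add, hz, hz']
      | smul_tprod t h =>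
        simp only [map_smul, tcomp_tprod, LinearMap.comp_assoc]

theorem tcomp_id_left (y : ⨂[k]^d (L →ₗ[k] M)) :
    tcomp k d L M M (PiTensorProduct.tprod k fun _ => LinearMap.id) y = y := by
  induction y using PiTensorProduct.induction_on with
  | add y y' hy hy' => simp only [map_add, hy, hy']
  | smul_tprod s g => simp only [map_smul, tcomp_tprod, LinearMap.id_comp]

theorem tcomp_id_right (y : ⨂[k]^d (L →ₗ[k] M)) :
    tcomp k d L L M y (PiTensorProduct.tprod k fun _ => LinearMap.id) = y := by
  induction y using PiTensorProduct.induction_on with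
  | add y y' hy hy' => simp only [map_add, LinearMap.add_apply, hy, hy']
  | smul_tprod s g =>
    simp only [map_smul, LinearMap.smul_apply, tcomp_tprod, LinearMap.comp_id]

theorem reindex_tcomp (σ : Equiv.Perm (Fin d)) (x : ⨂[k]^d (M →ₗ[k] N))
    (y : ⨂[k]^d (L →ₗ[k] M)) :
    PiTensorProduct.reindex k (fun _ => (L →ₗ[k] N)) σ (tcomp k d L M N x y) =
      tcomp k d L M N (PiTensorProduct.reindex k (fun _ => (M →ₗ[k] N)) σ x)
        (PiTensorProduct.reindex k (fun _ => (L →ₗ[k] M)) σ y) := by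
  induction x using PiTensorProduct.induction_on with
  | add x x' hx hx' => simp only [map_add, LinearMap.add_apply, hx, hx']
  | smul_tprod r f =>
    simp only [map_smul, LinearMap.smul_apply]
    congr 1
    induction y using PiTensorProduct.induction_on with
    | add y y' hy hy' => simp only [map_add, hy, hy']
    | smul_tprod s g =>
      simp only [map_smul]
      congr 1
      rw [tcomp_tprod, PiTensorProduct.reindex_tprod, PiTensorProduct.reindex_tprod,
        PiTensorProduct.reindex_tprod]
      exact (tcomp_tprod _ _).symm

theorem tcomp_mem_symSub {x : ⨂[k]^d (M →ₗ[k] N)} {y : ⨂[k]^d (L →ₗ[k] M)}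
    (hx : x ∈ symSub k (M →ₗ[k] N) d) (hy : y ∈ symSub k (L →ₗ[k] M) d) :
    tcomp k d L M N x y ∈ symSub k (L →ₗ[k] N) d := fun σ => by
  rw [reindex_tcomp, hx σ, hy σ]

theorem tprod_mem_symSub (v : M) :
    PiTensorProduct.tprod k (fun _ : Fin d => v) ∈ symSub k M d := fun σ =>
  PiTensorProduct.reindex_tprod σ _

end

/-- The category `Γ^d 𝒱`, with `Hom(V,W)` replaced by `Γ^d Hom(V,W)`. -/
noncomputable instance : Category (GammaV k d) where
  Hom V W := symSub k (V.carrier →ₗ[k] W.carrier) d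
  id _ := ⟨PiTensorProduct.tprod k fun _ => LinearMap.id, tprod_mem_symSub _⟩
  comp f g := ⟨tcomp k d _ _ _ g.1 f.1, tcomp_mem_symSub g.2 f.2⟩
  id_comp f := Subtype.ext (tcomp_id_right f.1)
  comp_id f := Subtype.ext (tcomp_id_left f.1)
  assoc f g h := Subtype.ext (tcomp_assoc h.1 g.1 f.1).symm

noncomputable instance : Preadditive (GammaV k d) where
  homGroup V W := inferInstanceAs (AddCommGroup (symSub k (V.carrier →ₗ[k] W.carrier) d))
  add_comp _ _ _ f g h := Subtype.ext (map_add (tcomp k d _ _ _ h.1) f.1 g.1)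
  comp_add _ _ _ f g h := Subtype.ext (LinearMap.map_add₂ (tcomp k d _ _ _) g.1 h.1 f.1)

noncomputable instance : Linear k (GammaV k d) where
  homModule V W := inferInstanceAs (Module k (symSub k (V.carrier →ₗ[k] W.carrier) d))
  smul_comp _ _ _ c f g := Subtype.ext (map_smul (tcomp k d _ _ _ g.1) c f.1)
  comp_smul _ _ _ f c g := Subtype.ext (LinearMap.map_smul₂ (tcomp k d _ _ _) c g.1 f.1)

/-- The vector space underlying a finite dimensional super vector space, in `Γ^d 𝒱`. -/
def ofSVec (d : ℕ) (X : FinSVec k) : GammaV k d := ⟨X.toSVec.carrier, X.finite⟩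

end GammaV

/-- The category `𝒫_d` of homogeneous strict polynomial functors of degree `d`: linear functors
from `Γ^d 𝒱` to finite dimensional vector spaces, and natural transformations. -/
structure StrictPoly (k : Type u) [Field k] (d : ℕ) where
  functor : GammaV k d ⥤ ModuleCat.{u} k
  [additive : functor.Additive]
  [linear : functor.Linear k]
  finite (V : GammaV k d) : FiniteDimensional k (functor.obj V)

attribute [instance] StrictPoly.additive StrictPoly.linear

noncomputable instance (k : Type u) [Field k] (d : ℕ) : Category (StrictPoly k d) where
  Hom F G := F.functor ⟶ G.functor
  id F := 𝟙 F.functor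
  comp f g := NatTrans.vcomp f g
  id_comp f := Category.id_comp (X := _) (Y := _) f
  comp_id f := Category.comp_id (X := _) (Y := _) f
  assoc f g h := Category.assoc (W := _) (X := _) (Y := _) (Z := _) f g h

/-! ## Evaluation of a strict polynomial functor on a super vector space -/

namespace StrictPoly

variable {k : Type u} [Field k] {d : ℕ}

/-- The tensor whose factor in position `a` is the projection on the odd part of `X` if `a ∈ S`,
the projection on the even part if `a ∉ S`. -/
noncomputable def projTensor (X : SVec k) (S : Finset (Fin d)) : ⨂[k]^d (X →ₗ[k] X) :=
  PiTensorProduct.tprod k fun a => if a ∈ S then X.proj 1 else X.proj 0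

theorem projTensor_comp (X : SVec k) (S T : Finset (Fin d)) :
    GammaV.tcomp k d X X X (projTensor X S) (projTensor X T) =
      if S = T then projTensor X S else 0 := by
  have h0 : ∀ i j, X.proj i ∘ₗ X.proj j = if i = j then X.proj j else 0 := fun i j => by
    refine LinearMap.ext fun v => ?_
    rw [LinearMap.comp_apply, X.proj_of_mem i j _ (X.proj_mem j v)]
    split_ifs <;> rfl
  have h1 : ¬ (1 : ZMod 2) = 0 := by decide
  have h2 : ¬ (0 : ZMod 2) = 1 := by decide
  rw [projTensor, projTensor, GammaV.tcomp_tprod]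
  split_ifs with h
  · subst h
    congr 1
    funext a
    split_ifs <;> simp [h0]
  · have : ∃ a, ¬ (a ∈ S ↔ a ∈ T) := by
      by_contra! hc
      exact h (Finset.ext hc)
    obtain ⟨a, ha⟩ := this
    refine MultilinearMap.map_coord_zero _ a ?_
    by_cases hS : a ∈ S <;> by_cases hT : a ∈ T <;> simp_all

/-- The coefficient of `t^j` in `(π_0 + t π_1)^{⊗d} ∈ Γ^d End(X) ⊗ k[t]`, where `π_0`, `π_1` are
the projections on the even and odd parts of `X`. -/
noncomputable def weightTensor (X : SVec k) (d j : ℕ) : ⨂[k]^d (X →ₗ[k] X) :=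
  ∑ S : Finset (Fin d), if S.card = j then projTensor X S else 0

theorem weightTensor_mem (X : SVec k) (j : ℕ) :
    weightTensor X d j ∈ symSub k (X →ₗ[k] X) d := fun σ => by
  rw [weightTensor, map_sum]
  conv_rhs => rw [← Equiv.sum_comp (Equiv.finsetCongr σ)]
  refine Finset.sum_congr rfl fun S _ => ?_
  have hc : (Equiv.finsetCongr σ S).card = S.card := by simp [Equiv.finsetCongr_apply]
  rw [hc]
  split_ifs
  · rw [projTensor, projTensor, PiTensorProduct.reindex_tprod]
    congr 1
    funext a
    simp [Equiv.finsetCongr_apply, Finset.mem_map_equiv]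
  · rw [map_zero]

theorem weightTensor_comp (X : SVec k) (i j : ℕ) :
    GammaV.tcomp k d X X X (weightTensor X d i) (weightTensor X d j) =
      if i = j then weightTensor X d i else 0 := by
  simp only [weightTensor, map_sum, LinearMap.sum_apply]
  split_ifs with h
  · subst h
    refine Finset.sum_congr rfl fun S _ => ?_
    rw [Finset.sum_eq_single S]
    · split_ifs
      · rw [projTensor_comp, if_pos rfl]
      · simp
    · intro T _ hT
      split_ifs <;> simp only [projTensor_comp, if_neg hT, map_zero, LinearMap.zero_apply]
    · simp
  · refine Finset.sum_eq_zero fun S _ => Finset.sum_eq_zero fun T _ => ?_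
    split_ifs with hS hT
    · rw [projTensor_comp, if_neg]
      rintro rfl
      exact h (by rw [← hS, ← hT])
    all_goals simp

theorem sum_weightTensor (X : SVec k) :
    ∑ j ∈ Finset.range (d + 1), weightTensor X d j =
      PiTensorProduct.tprod k fun _ => LinearMap.id := by
  have h1 : ∑ j ∈ Finset.range (d + 1), weightTensor X d j =
      ∑ S : Finset (Fin d), projTensor X S := by
    simp only [weightTensor]
    rw [Finset.sum_comm]
    refine Finset.sum_congr rfl fun S _ => ?_
    rw [Finset.sum_ite_eq, if_pos]
    have := S.card_le_univ
    rw [Fintype.card_fin] at this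
    exact Finset.mem_range.2 (Nat.lt_succ_of_le this)
  have h2 : (LinearMap.id : X →ₗ[k] X) = X.proj 1 + X.proj 0 := by
    rw [add_comm]
    exact LinearMap.ext fun v => (X.proj_add_proj v).symm
  have h3 := MultilinearMap.map_add_univ
    (PiTensorProduct.tprod k (s := fun _ : Fin d => (X →ₗ[k] X)))
    (fun _ => X.proj 1) (fun _ => X.proj 0)
  rw [h1, h2]
  refine Eq.trans ?_ h3.symm
  refine Finset.sum_congr rfl fun S _ => ?_
  rw [projTensor]
  congr 1

/-- The `j`-th coefficient of `(π_0 + t π_1)^{⊗d}`, as an endomorphism of `X` in `Γ^d 𝒱`. -/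
noncomputable def weightHom (d : ℕ) (X : FinSVec k) (j : ℕ) :
    GammaV.ofSVec d X ⟶ GammaV.ofSVec d X :=
  (⟨weightTensor X.toSVec d j, weightTensor_mem X.toSVec j⟩ :
    symSub k (X.toSVec →ₗ[k] X.toSVec) d)

theorem weightHom_comp (X : FinSVec k) (i j : ℕ) :
    weightHom d X j ≫ weightHom d X i = if i = j then weightHom d X i else 0 := by
  refine Subtype.ext ((weightTensor_comp X.toSVec i j).trans ?_)
  split_ifs <;> rfl

theorem sum_weightHom (X : FinSVec k) :
    ∑ j ∈ Finset.range (d + 1), weightHom d X j = 𝟙 (GammaV.ofSVec d X) := by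
  refine Subtype.ext (Eq.trans ?_ (sum_weightTensor X.toSVec))
  exact map_sum (symSub k (X.toSVec →ₗ[k] X.toSVec) d).subtype
    (fun j => ⟨weightTensor X.toSVec d j, weightTensor_mem X.toSVec j⟩) _

variable (F : StrictPoly k d) (X : FinSVec k)

/-- The endomorphism of `F(X)` by which the `j`-th coefficient of `(π_0 + t π_1)^{⊗d}` acts. -/
noncomputable def weightProj (j : ℕ) :
    F.functor.obj (GammaV.ofSVec d X) →ₗ[k] F.functor.obj (GammaV.ofSVec d X) :=
  (F.functor.map (weightHom d X j)).hom

/-- The weight `j` part of `F(X)` for the action of the multiplicative group on `X` with weight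
`0` on the even and weight `1` on the odd part: `t` acts on `F(X)` by `F((π_0 + t π_1)^{⊗d})`,
that is by `∑ j, t^j • weightProj j`, where the `weightProj j` are orthogonal projections. -/
noncomputable def weightSpace (j : ℕ) : Submodule k (F.functor.obj (GammaV.ofSVec d X)) :=
  LinearMap.range (weightProj F X j)

theorem weightProj_comp (i j : ℕ) :
    weightProj F X i ∘ₗ weightProj F X j = if i = j then weightProj F X i else 0 := by
  have h : weightProj F X i ∘ₗ weightProj F X j =
      (F.functor.map (weightHom d X j ≫ weightHom d X i)).hom := by
    rw [F.functor.map_comp]; rfl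
  rw [h, weightHom_comp]
  split_ifs
  · rfl
  · rw [Functor.map_zero]; rfl

theorem sum_weightProj :
    ∑ j ∈ Finset.range (d + 1), weightProj F X j = LinearMap.id := by
  have h' := congrArg (fun f => (F.functor.map f).hom) (sum_weightHom (d := d) X)
  simp only [Functor.map_sum, ModuleCat.hom_sum] at h'
  rw [F.functor.map_id] at h'
  exact h'

/-- The super vector space `F(X)`, where `X` is a super vector space: its underlying space is `F`
of the underlying space of `X`, and its grading is the weight grading reduced modulo `2`. -/
noncomputable def evalSuper : SVec k where
  carrier := F.functor.obj (GammaV.ofSVec d X)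
  gr i := ⨆ (j : ℕ) (_ : (j : ZMod 2) = i), weightSpace F X j
  isCompl := by
    have hz : ∀ j, d < j → weightProj F X j = 0 := by
      intro j hj
      refine LinearMap.ext fun x => ?_
      have hx : ∑ l ∈ Finset.range (d + 1), weightProj F X l x = x := by
        rw [← LinearMap.sum_apply, sum_weightProj]; rfl
      rw [← hx, map_sum]
      refine Finset.sum_eq_zero fun l hl => ?_
      rw [← LinearMap.comp_apply, weightProj_comp, if_neg, LinearMap.zero_apply]
      have := Finset.mem_range.1 hl
      omega
    refine SVec.isCompl_of_proj
      (fun i => ⨆ (j : ℕ) (_ : (j : ZMod 2) = i), weightSpace F X j)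
      (fun i => ∑ j ∈ Finset.range (d + 1), if (j : ZMod 2) = i then weightProj F X j else 0)
      ?_ ?_ ?_
    · intro i x
      rw [LinearMap.sum_apply]
      refine sum_mem fun j _ => ?_
      split_ifs with h
      · exact Submodule.mem_iSup_of_mem j (Submodule.mem_iSup_of_mem h ⟨x, rfl⟩)
      · exact zero_mem _
    · intro x
      have h : ∀ a : ZMod 2, a = 0 ∨ a = 1 := by decide
      have h1 : ¬ (1 : ZMod 2) = 0 := by decide
      have h2 : ¬ (0 : ZMod 2) = 1 := by decide
      rw [← LinearMap.add_apply, ← Finset.sum_add_distrib]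
      have h3 : ∑ j ∈ Finset.range (d + 1),
          ((if (j : ZMod 2) = 0 then weightProj F X j else 0) +
            if (j : ZMod 2) = 1 then weightProj F X j else 0) =
          ∑ j ∈ Finset.range (d + 1), weightProj F X j :=
        Finset.sum_congr rfl fun j _ => by rcases h j with h | h <;> simp [h]
      rw [h3, sum_weightProj]
      rfl
    · intro i x hx
      have hle : (⨆ (j : ℕ) (_ : (j : ZMod 2) = i), weightSpace F X j) ≤
          LinearMap.ker (∑ j ∈ Finset.range (d + 1),
            if (j : ZMod 2) = i + 1 then weightProj F X j else 0) := by
        refine iSup₂_le fun j hj => ?_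
        rintro _ ⟨y, rfl⟩
        rw [LinearMap.mem_ker, LinearMap.sum_apply]
        refine Finset.sum_eq_zero fun l _ => ?_
        split_ifs with hl
        · have : l ≠ j := by
            rintro rfl
            exact SVec.add_one_ne i (hl.symm.trans hj)
          rw [← LinearMap.comp_apply, weightProj_comp, if_neg this, LinearMap.zero_apply]
        · rfl
      exact hle hx

end StrictPoly

/-! ## Precomposition by an additive superfunctor -/

/-- The isomorphism `M^{⊗(d*n)} → (M^{⊗n})^{⊗d}` cutting a tensor into `d` blocks of `n`
consecutive factors. -/
noncomputable def splitTensor (k : Type u) [Field k] (M : Type u) [AddCommGroup M] [Module k M]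
    (d n : ℕ) : (⨂[k]^(d * n) M) →ₗ[k] (⨂[k]^d (⨂[k]^n M)) :=
  PiTensorProduct.lift
    (((PiTensorProduct.tprod k (s := fun _ : Fin d => ⨂[k]^n M)).compMultilinearMap
      fun _ => PiTensorProduct.tprod k (s := fun _ : Fin n => M)).domDomCongr
        ((Equiv.sigmaEquivProd (Fin d) (Fin n)).trans finProdFinEquiv))

theorem splitTensor_tprod (k : Type u) [Field k] (M : Type u) [AddCommGroup M] [Module k M]
    (d n : ℕ) (v : Fin (d * n) → M) :
    splitTensor k M d n (PiTensorProduct.tprod k v) =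
      PiTensorProduct.tprod k fun a : Fin d =>
        PiTensorProduct.tprod k fun b : Fin n => v (finProdFinEquiv (a, b)) := by
  rw [splitTensor, PiTensorProduct.lift.tprod]
  rfl

namespace Superfunctor

variable {k : Type u} [Field k] {n : ℕ}

/-- `y` is the image of `x` under
`Γ^{d*n} Hom(V,W) → Γ^d (Γ^n Hom(V,W)) → Γ^d Hom(A(V),A(W))`: the first map is the restriction of
`splitTensor`, under which `x` corresponds to `z`; the second one is `Γ^d` of the linear map
`Γ^n Hom(V,W) → Hom(A(V),A(W))` given by `A`. -/
def GammaMap (A : Superfunctor k n) (hA : A.HasFiniteValues) (d : ℕ) {V W : FinSVec k}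
    (x : (⟨V⟩ : GammaSV k (d * n)) ⟶ ⟨W⟩)
    (y : GammaV.ofSVec d (A.fobj hA V) ⟶ GammaV.ofSVec d (A.fobj hA W)) : Prop :=
  ∃ z : (GammaSV.homSVec n V W).gamma d,
    PiTensorProduct.map
        (fun _ => ((SVec.ihom V.toSVec W.toSVec).gammaSub n).subtype) z.1 =
      splitTensor k (SVec.ihom V.toSVec W.toSVec) d n x.1 ∧
    PiTensorProduct.map (fun _ => A.mapLin V W) z.1 = y.1

/-- `Φ` is precomposition by `A`: up to isomorphisms of super vector spaces
`Φ(F)(V) ≃ F(A(V))`, the map of `Φ(F)` on morphisms is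
`Γ^{d*n} Hom(V,W) → Γ^d (Γ^n Hom(V,W)) → Γ^d Hom(A(V),A(W)) → Hom(F(A(V)),F(A(W)))`, and for a
natural transformation `φ`, the component of `Φ(φ)` at `V` is the component of `φ` at `A(V)`. -/
def IsPrecomposition (A : Superfunctor k n) (hA : A.HasFiniteValues) {d : ℕ}
    (Φ : StrictPoly k d ⥤ PolySuperEv k (d * n)) : Prop :=
  ∃ e : ∀ (F : StrictPoly k d) (V : FinSVec k),
      ((Φ.obj F).functor.obj ⟨V⟩).carrier ≃ₗ[k] (F.evalSuper (A.fobj hA V)).carrier,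
    (∀ F V i u, u ∈ ((Φ.obj F).functor.obj ⟨V⟩).gr i ↔
      e F V u ∈ (F.evalSuper (A.fobj hA V)).gr i) ∧
    (∀ (F : StrictPoly k d) (V W : FinSVec k) (x : (⟨V⟩ : GammaSV k (d * n)) ⟶ ⟨W⟩),
      ∃ y : GammaV.ofSVec d (A.fobj hA V) ⟶ GammaV.ofSVec d (A.fobj hA W), A.GammaMap hA d x y ∧
        ∀ u, e F W (SVec.toLin ((Φ.obj F).functor.map x) u) =
          (F.functor.map y).hom (e F V u)) ∧
    (∀ (F G : StrictPoly k d) (φ : F ⟶ G) (V : FinSVec k) (u),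
      e G V (SVec.toLin ((Φ.map φ).nat.app ⟨V⟩) u) =
        (NatTrans.app φ (GammaV.ofSVec d (A.fobj hA V))).hom (e F V u))

end Superfunctor

/-!
An additive superfunctor `A` of degree `n = p ^ r` is additive on the morphisms `f ⊗ ⋯ ⊗ f` with
`f` even (`Superfunctor.map_powHom_add`). Hence the identity of `A(V)` is the sum of the maps
`A(P ⊗ ⋯ ⊗ P)`, where `P` runs over the projections on the lines of a homogeneous basis of `V`, and
any `A(f)` is a sum of maps `A(g)`, where `g` lies in the line spanned by `u ⊗ ⋯ ⊗ u` for a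
homogeneous map `u` of rank one. If `u` is even, then so is `g`. If `u` is odd, exchanging two
factors changes the sign of `u ⊗ ⋯ ⊗ u`; as `n ≥ 2`, `2 ≠ 0` and `g` is invariant, `g = 0`. So `A(f)`
is even (`Superfunctor.IsAdditive.mapsToEven`), and it vanishes if `f` is odd.

For the precomposition, an invariant tensor of `H^{⊗(d*n)}`, cut into `d` blocks, is invariant under
`Σ_n` in each block, so it lies in the image of `(Γ^n H)^{⊗d}`; permuting the blocks shows that it
lies in that of `Γ^d (Γ^n H)` (`SVec.exists_gamma_splitTensor`). The Koszul signs are compatible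
with the blocks, and those between different blocks disappear under `A`, because `A` kills odd
morphisms. This makes `V ↦ A(V)` a functor `Γ^{d*n} 𝐕 ⥤ Γ^d 𝒱` (`Superfunctor.gammaFunctor`), through
which precomposition by `A` is defined. The morphisms in its image are tensors with even factors, so they
commute with the weight projections, and `F ∘ A` is a superfunctor for the weight grading modulo `2`.

For exactness, forget the gradings: precomposition by `A` becomes precomposition with
`Superfunctor.gammaFunctor`. Finite limits and colimits of strict polynomial functors are computed
in the category of all functors `Γ^d 𝒱 ⥤ Mod k`, where they are pointwise, so that precomposition
preserves them. The functor which forgets the gradings of superfunctors reflects limits and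
colimits: a map into a limit is even as soon as its components are, and dually.
-/

/-! ### Tensor powers of even maps -/

namespace SVec

variable {k : Type u} [Field k]

theorem proj_comp_of_even {X Y : SVec k} (f : X →ₗ[k] Y)
    (hf : ∀ j, ∀ v ∈ X.gr j, f v ∈ Y.gr j) (i : ZMod 2) : Y.proj i ∘ₗ f = f ∘ₗ X.proj i := by
  refine LinearMap.ext fun v => ?_
  have h := X.sum_proj v
  rw [LinearMap.comp_apply, LinearMap.comp_apply]
  conv_lhs => rw [← h]
  rw [map_sum, map_sum, Finset.sum_eq_single i]
  · rw [Y.proj_of_mem i i _ (hf i _ (X.proj_mem i v)), if_pos rfl]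
  · intro j _ hj
    rw [Y.proj_of_mem i j _ (hf j _ (X.proj_mem j v)), if_neg (Ne.symm hj)]
  · simp

theorem mem_gr_iff_proj_add_one (X : SVec k) (i : ZMod 2) (v : X) :
    v ∈ X.gr i ↔ X.proj (i + 1) v = 0 := by
  constructor
  · intro hv
    rw [X.proj_of_mem _ i v hv, if_neg (add_one_ne i)]
  · intro h
    have hs := X.sum_proj v
    have : (∑ j, X.proj j v) = X.proj i v := by
      rw [Finset.sum_eq_single i]
      · intro j _ hj
        rw [eq_add_one i j hj.symm, h]
      · simp
    rw [← hs, this]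
    exact X.proj_mem i v

theorem sum_parityProj (V : SVec k) {n : ℕ} (x : ⨂[k]^n V) :
    ∑ ε : Fin n → ZMod 2, V.parityProj ε x = x := by
  rw [← LinearMap.sum_apply]
  have : (∑ ε : Fin n → ZMod 2, V.parityProj ε) = LinearMap.id := by
    refine V.tpow_ext fun δ v hv => ?_
    simp [LinearMap.sum_apply, parityProj_tprod V _ δ v hv]
  rw [this, LinearMap.id_apply]

theorem parityProj_map {X Y : SVec k} {n : ℕ} (f : X →ₗ[k] Y)
    (hf : ∀ j, ∀ v ∈ X.gr j, f v ∈ Y.gr j) (ε : Fin n → ZMod 2) (x : ⨂[k]^n X) :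
    Y.parityProj ε (PiTensorProduct.map (fun _ => f) x) =
      PiTensorProduct.map (fun _ => f) (X.parityProj ε x) := by
  rw [parityProj, parityProj, ← LinearMap.comp_apply, ← LinearMap.comp_apply,
    ← PiTensorProduct.map_comp, ← PiTensorProduct.map_comp]
  simp only [proj_comp_of_even f hf]

theorem permAct_map {X Y : SVec k} {n : ℕ} (f : X →ₗ[k] Y)
    (hf : ∀ j, ∀ v ∈ X.gr j, f v ∈ Y.gr j) (σ : Equiv.Perm (Fin n)) (x : ⨂[k]^n X) :
    Y.permAct σ (PiTensorProduct.map (fun _ => f) x) =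
      PiTensorProduct.map (fun _ => f) (X.permAct σ x) := by
  induction x using X.tpow_induction with
  | hom ε v hv =>
    rw [PiTensorProduct.map_tprod, permAct_tprod Y σ ε _ fun a => hf _ _ (hv a),
      permAct_tprod X σ ε v hv, map_smul, PiTensorProduct.map_tprod]
  | zero => simp only [map_zero]
  | add x y hx hy => simp only [map_add, hx, hy]
  | smul c x hx => simp only [map_smul, hx]

/-- The tensor power of an even linear map whose values are all even kills every tensor of
homogeneous factors one of which is odd. -/
theorem map_parityProj_of_forall_even {X Y : SVec k} {n : ℕ} (f : X →ₗ[k] Y)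
    (hf : ∀ j, ∀ v ∈ X.gr j, f v ∈ Y.gr j) (h0 : ∀ v, f v ∈ Y.gr 0) (ε : Fin n → ZMod 2)
    (x : ⨂[k]^n X) : PiTensorProduct.map (fun _ => f) (X.parityProj ε x) =
      if ε = 0 then PiTensorProduct.map (fun _ => f) x else 0 := by
  rw [← parityProj_map f hf]
  induction x using PiTensorProduct.induction_on with
  | smul_tprod r v =>
    rw [map_smul, map_smul, PiTensorProduct.map_tprod,
      parityProj_tprod Y ε 0 _ fun a => h0 (v a)]
    split_ifs <;> simp
  | add x y hx hy =>
    simp only [map_add, hx, hy]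
    split_ifs <;> simp

/-- No signs enter when all factors are even. -/
theorem permAct_eq_reindex {X : SVec k} {n : ℕ} (σ : Equiv.Perm (Fin n)) (x : ⨂[k]^n X)
    (hx : ∀ ε, ε ≠ 0 → X.parityProj ε x = 0) :
    X.permAct σ x = PiTensorProduct.reindex k (fun _ => X.carrier) σ x := by
  have h0 : X.parityProj 0 x = x := by
    conv_rhs => rw [← X.sum_parityProj x]
    exact (Finset.sum_eq_single _ (fun ε _ h => hx ε h) (by simp)).symm
  rw [permAct, LinearMap.sum_apply, Finset.sum_eq_single 0]
  · rw [LinearMap.smul_apply, LinearMap.comp_apply, h0]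
    simp [permExp, ksgn_zero]
  · intro ε _ h
    rw [LinearMap.smul_apply, LinearMap.comp_apply, hx ε h, map_zero, smul_zero]
  · simp

/-- The map `X^{⊗n} ⊗ Y^{⊗n} → Z^{⊗n}` induced by a bilinear map `μ`, with the Koszul signs of
the interchange of the two families of factors. -/
noncomputable def signedMap₂ {X Y Z : SVec k} (μ : X →ₗ[k] Y →ₗ[k] Z) (n : ℕ) :
    (⨂[k]^n X) →ₗ[k] (⨂[k]^n Y) →ₗ[k] (⨂[k]^n Z) :=
  ∑ ε : Fin n → ZMod 2, ∑ δ : Fin n → ZMod 2, ksgn k (compExp ε δ) •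
    (PiTensorProduct.map₂ (R := k) (s := fun _ : Fin n => X.carrier)
      (t := fun _ : Fin n => Y.carrier) (t' := fun _ : Fin n => Z.carrier)
      fun _ => μ).compl₁₂ (X.parityProj ε) (Y.parityProj δ)

theorem signedMap₂_tprod {X Y Z : SVec k} (μ : X →ₗ[k] Y →ₗ[k] Z) {n : ℕ}
    (ε δ : Fin n → ZMod 2) (f : Fin n → X) (g : Fin n → Y) (hf : ∀ a, f a ∈ X.gr (ε a))
    (hg : ∀ a, g a ∈ Y.gr (δ a)) :
    signedMap₂ μ n (PiTensorProduct.tprod k f) (PiTensorProduct.tprod k g) =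
      ksgn k (compExp ε δ) • PiTensorProduct.tprod k fun a => μ (f a) (g a) := by
  simp only [signedMap₂, LinearMap.sum_apply, LinearMap.smul_apply, LinearMap.compl₁₂_apply]
  rw [Finset.sum_eq_single ε, Finset.sum_eq_single δ]
  · rw [parityProj_tprod _ ε ε f hf, parityProj_tprod _ δ δ g hg, if_pos rfl, if_pos rfl]
    congr 1
    exact PiTensorProduct.map₂_tprod_tprod _ _ _
  · intro δ' _ h
    rw [parityProj_tprod _ δ' δ g hg, if_neg h, map_zero, smul_zero]
  · simp
  · intro ε' _ h
    refine Finset.sum_eq_zero fun δ' _ => ?_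
    rw [parityProj_tprod _ ε' ε f hf, if_neg h, map_zero, LinearMap.zero_apply, smul_zero]
  · simp

theorem map_signedMap₂ {X Y Z X' Y' Z' : SVec k} {n : ℕ} (μ : X →ₗ[k] Y →ₗ[k] Z)
    (μ' : X' →ₗ[k] Y' →ₗ[k] Z') (α : X →ₗ[k] X') (β : Y →ₗ[k] Y') (γ : Z →ₗ[k] Z')
    (hα : ∀ j, ∀ v ∈ X.gr j, α v ∈ X'.gr j) (hβ : ∀ j, ∀ v ∈ Y.gr j, β v ∈ Y'.gr j)
    (h : ∀ x y, γ (μ x y) = μ' (α x) (β y)) (x : ⨂[k]^n X) (y : ⨂[k]^n Y) :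
    PiTensorProduct.map (fun _ => γ) (signedMap₂ μ n x y) =
      signedMap₂ μ' n (PiTensorProduct.map (fun _ => α) x)
        (PiTensorProduct.map (fun _ => β) y) := by
  induction x using X.tpow_induction with
  | zero => simp only [map_zero, LinearMap.zero_apply]
  | add x x' hx hx' => simp only [map_add, LinearMap.add_apply, hx, hx']
  | smul c x hx => simp only [map_smul, LinearMap.smul_apply, hx]
  | hom ε f hf =>
    induction y using Y.tpow_induction with
    | zero => simp only [map_zero]
    | add y y' hy hy' => simp only [map_add, hy, hy']
    | smul c y hy => simp only [map_smul, hy]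
    | hom δ g hg =>
      rw [signedMap₂_tprod μ ε δ f g hf hg, map_smul, PiTensorProduct.map_tprod,
        PiTensorProduct.map_tprod, PiTensorProduct.map_tprod,
        signedMap₂_tprod μ' ε δ _ _ (fun a => hα _ _ (hf a)) (fun a => hβ _ _ (hg a))]
      simp only [h]

/-- No signs enter when all factors of both tensors are even. -/
theorem signedMap₂_eq_map₂ {X Y Z : SVec k} (μ : X →ₗ[k] Y →ₗ[k] Z) {n : ℕ} (x : ⨂[k]^n X)
    (y : ⨂[k]^n Y) (hx : ∀ ε, X.parityProj ε x = if ε = 0 then x else 0)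
    (hy : ∀ ε, Y.parityProj ε y = if ε = 0 then y else 0) :
    signedMap₂ μ n x y = PiTensorProduct.map₂ (fun _ => μ) x y := by
  simp only [signedMap₂, LinearMap.sum_apply, LinearMap.smul_apply, LinearMap.compl₁₂_apply]
  rw [Finset.sum_eq_single 0, Finset.sum_eq_single 0]
  · rw [hx, hy, if_pos rfl, if_pos rfl]
    simp [compExp, ksgn_zero]
  · intro δ _ h
    rw [hy, if_neg h, map_zero, smul_zero]
  · simp
  · intro ε _ h
    refine Finset.sum_eq_zero fun δ _ => ?_
    rw [hx ε, if_neg h, map_zero, LinearMap.zero_apply, smul_zero]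
  · simp

/-- The super vector space `V^{⊗n}`, graded by the total parity. -/
noncomputable def tpow (V : SVec k) (n : ℕ) : SVec k where
  carrier := ⨂[k]^n V
  gr := V.tpowGr n
  isCompl := isCompl_of_proj (V.tpowGr n) (V.tproj n) (V.tproj_mem)
    V.tproj_add_tproj V.tproj_of_mem

theorem tprod_mem_tpow (V : SVec k) {n : ℕ} (ε : Fin n → ZMod 2) (v : Fin n → V)
    (hv : ∀ a, v a ∈ V.gr (ε a)) : PiTensorProduct.tprod k v ∈ (V.tpow n).gr (∑ a, ε a) :=
  show PiTensorProduct.tprod k v ∈ V.tpowGr n _ from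
    Submodule.subset_span ⟨ε, v, hv, rfl, rfl⟩

/-- A tensor of odd total parity has no component all of whose factors are even. -/
theorem parityProj_zero_of_mem_one (V : SVec k) {n : ℕ} {x : ⨂[k]^n V}
    (hx : x ∈ V.tpowGr n 1) : V.parityProj 0 x = 0 := by
  induction hx using Submodule.span_induction with
  | mem x h =>
    obtain ⟨ε, v, hv, hi, rfl⟩ := h
    rw [parityProj_tprod V 0 ε v hv, if_neg]
    rintro rfl
    simp at hi
  | zero => simp
  | add x y _ _ hx hy => rw [map_add, hx, hy, add_zero]
  | smul c x _ hx => rw [map_smul, hx, smul_zero]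

theorem ksgn_sum {ι : Type*} (s : Finset ι) (e : ι → ZMod 2) :
    ksgn k (∑ i ∈ s, e i) = ∏ i ∈ s, ksgn k (e i) := by
  classical
  induction s using Finset.induction_on with
  | empty => simp [ksgn_zero]
  | insert a s ha ih => rw [Finset.sum_insert ha, Finset.prod_insert ha, ksgn_add, ih]

/-! ### Cutting a tensor into blocks -/

/-- The factors of a tensor cut into blocks are ordered lexicographically. -/
theorem finProdFinEquiv_lt_iff {d n : ℕ} (a a' : Fin d) (b b' : Fin n) :
    finProdFinEquiv (a, b) < finProdFinEquiv (a', b') ↔ a < a' ∨ a = a' ∧ b < b' := by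
  simp only [Fin.lt_def, finProdFinEquiv_apply_val, Fin.ext_iff]
  have hb := b.2
  have hb' := b'.2
  rcases lt_trichotomy a.1 a'.1 with h | h | h
  · have : n * (a.1 + 1) ≤ n * a'.1 := Nat.mul_le_mul_left n h
    rw [mul_add] at this
    omega
  · rw [h]; omega
  · have : n * (a'.1 + 1) ≤ n * a.1 := Nat.mul_le_mul_left n h
    rw [mul_add] at this
    omega

theorem sum_finProdFinEquiv {M : Type*} [AddCommMonoid M] {d n : ℕ} (g : Fin (d * n) → M) :
    ∑ c, g c = ∑ a, ∑ b, g (finProdFinEquiv (a, b)) := by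
  rw [← Equiv.sum_comp finProdFinEquiv g, Fintype.sum_prod_type]

/-- The sign exponent of an interchange of `d * n` factors is that of the interchange of the `d`
blocks, plus those of the interchanges inside the blocks. -/
theorem compExp_block {d n : ℕ} (ε δ : Fin (d * n) → ZMod 2) :
    compExp ε δ =
      compExp (fun a => ∑ b, ε (finProdFinEquiv (a, b))) (fun a => ∑ b, δ (finProdFinEquiv (a, b)))
      + ∑ a, compExp (fun b => ε (finProdFinEquiv (a, b)))
          (fun b => δ (finProdFinEquiv (a, b))) := by
  simp only [compExp, sum_finProdFinEquiv, finProdFinEquiv_lt_iff, ← Finset.sum_add_distrib]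
  refine Finset.sum_congr rfl fun a _ => ?_
  have h1 : ∀ b, (∑ b' : Fin n, if b' < b then ε (finProdFinEquiv (a, b)) *
      δ (finProdFinEquiv (a, b')) else 0) = ∑ a' : Fin d, if a' = a then (∑ b' : Fin n,
        if b' < b then ε (finProdFinEquiv (a, b)) * δ (finProdFinEquiv (a', b')) else 0) else 0 :=
    fun b => by simp
  simp only [h1]
  rw [Finset.sum_comm, Finset.sum_comm (s := (Finset.univ : Finset (Fin n))),
    ← Finset.sum_add_distrib]
  refine Finset.sum_congr rfl fun a' _ => ?_
  rcases lt_trichotomy a' a with h | rfl | h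
  · simp only [h, h.ne, true_or, if_true, if_false, Finset.sum_const_zero, add_zero,
      Finset.sum_mul_sum]
  · simp
  · simp [h.not_gt, h.ne']

/-- The permutation of the blocks. -/
def blockPerm {d : ℕ} (n : ℕ) (τ : Equiv.Perm (Fin d)) : Equiv.Perm (Fin (d * n)) :=
  finProdFinEquiv.permCongr (Equiv.prodCongr τ (Equiv.refl (Fin n)))

/-- The permutation preserving the blocks and acting by `σ a` inside the block `a`. -/
def innerPerm {d n : ℕ} (σ : Fin d → Equiv.Perm (Fin n)) : Equiv.Perm (Fin (d * n)) :=
  finProdFinEquiv.permCongr (Equiv.prodCongrRight σ)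

theorem blockPerm_apply {d n : ℕ} (τ : Equiv.Perm (Fin d)) (a : Fin d) (b : Fin n) :
    blockPerm n τ (finProdFinEquiv (a, b)) = finProdFinEquiv (τ a, b) := by
  simp [blockPerm, Equiv.permCongr_apply]

theorem blockPerm_symm_apply {d n : ℕ} (τ : Equiv.Perm (Fin d)) (a : Fin d) (b : Fin n) :
    (blockPerm n τ).symm (finProdFinEquiv (a, b)) = finProdFinEquiv (τ.symm a, b) := by
  rw [Equiv.symm_apply_eq, blockPerm_apply, Equiv.apply_symm_apply]

theorem innerPerm_apply {d n : ℕ} (σ : Fin d → Equiv.Perm (Fin n)) (a : Fin d) (b : Fin n) :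
    innerPerm σ (finProdFinEquiv (a, b)) = finProdFinEquiv (a, σ a b) := by
  simp [innerPerm, Equiv.permCongr_apply]

theorem innerPerm_symm_apply {d n : ℕ} (σ : Fin d → Equiv.Perm (Fin n)) (a : Fin d) (b : Fin n) :
    (innerPerm σ).symm (finProdFinEquiv (a, b)) = finProdFinEquiv (a, (σ a).symm b) := by
  rw [Equiv.symm_apply_eq, innerPerm_apply, Equiv.apply_symm_apply]

theorem permExp_blockPerm {d n : ℕ} (τ : Equiv.Perm (Fin d)) (ε : Fin (d * n) → ZMod 2) :
    permExp (blockPerm n τ) ε = permExp τ fun a => ∑ b, ε (finProdFinEquiv (a, b)) := by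
  simp only [permExp, sum_finProdFinEquiv, finProdFinEquiv_lt_iff, blockPerm_apply]
  refine Finset.sum_congr rfl fun a _ => ?_
  rw [Finset.sum_comm]
  refine Finset.sum_congr rfl fun a' _ => ?_
  rw [Finset.sum_mul_sum]
  by_cases h : a < a' ∧ τ a' < τ a
  · simp [h]
  · rw [if_neg h]
    refine Finset.sum_eq_zero fun b _ => Finset.sum_eq_zero fun b' _ => if_neg ?_
    rintro ⟨h1 | h1, h2 | h2⟩
    · exact h ⟨h1, h2⟩
    · exact h1.ne (τ.injective h2.1).symm
    · exact h2.ne (congrArg τ h1.1.symm)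
    · exact h1.2.not_gt h2.2

theorem permExp_innerPerm {d n : ℕ} (σ : Fin d → Equiv.Perm (Fin n)) (ε : Fin (d * n) → ZMod 2) :
    permExp (innerPerm σ) ε = ∑ a, permExp (σ a) fun b => ε (finProdFinEquiv (a, b)) := by
  simp only [permExp, sum_finProdFinEquiv, finProdFinEquiv_lt_iff, innerPerm_apply]
  refine Finset.sum_congr rfl fun a _ => Finset.sum_congr rfl fun b _ => ?_
  rw [Finset.sum_eq_single a]
  · simp
  · intro a' _ h
    refine Finset.sum_eq_zero fun b' _ => if_neg ?_
    rintro ⟨h1 | h1, h2 | h2⟩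
    · exact h1.not_gt h2
    · exact h h2.1
    · exact h h1.1.symm
    · exact h h2.1
  · simp

section Split

variable (H : SVec k) {d n : ℕ}

theorem splitTensor_hom (ε : Fin (d * n) → ZMod 2) (v : Fin (d * n) → H)
    (hv : ∀ a, v a ∈ H.gr (ε a)) (a : Fin d) :
    PiTensorProduct.tprod k (fun b : Fin n => v (finProdFinEquiv (a, b))) ∈
      (H.tpow n).gr (∑ b, ε (finProdFinEquiv (a, b))) :=
  H.tprod_mem_tpow (fun b => ε (finProdFinEquiv (a, b))) _ fun _ => hv _

theorem splitTensor_permAct_blockPerm (τ : Equiv.Perm (Fin d)) (x : ⨂[k]^(d * n) H) :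
    splitTensor k H d n (H.permAct (blockPerm n τ) x) =
      (H.tpow n).permAct τ (splitTensor k H d n x) := by
  induction x using H.tpow_induction with
  | hom ε v hv =>
    rw [permAct_tprod H _ ε v hv, map_smul, splitTensor_tprod, splitTensor_tprod,
      permExp_blockPerm]
    refine Eq.trans ?_ (permAct_tprod (H.tpow n) τ _ _ (H.splitTensor_hom ε v hv)).symm
    simp only [blockPerm_symm_apply]
    rfl
  | zero =>
    simp only [map_zero]
    exact (map_zero ((H.tpow n).permAct τ)).symm
  | add x y hx hy =>
    simp only [map_add, hx, hy]
    exact (map_add ((H.tpow n).permAct τ) _ _).symm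
  | smul c x hx =>
    simp only [map_smul, hx]
    exact (map_smul ((H.tpow n).permAct τ) _ _).symm

theorem splitTensor_permAct_innerPerm (σ : Fin d → Equiv.Perm (Fin n)) (x : ⨂[k]^(d * n) H) :
    splitTensor k H d n (H.permAct (innerPerm σ) x) =
      PiTensorProduct.map (fun a => H.permAct (σ a)) (splitTensor k H d n x) := by
  induction x using H.tpow_induction with
  | hom ε v hv =>
    rw [permAct_tprod H _ ε v hv, map_smul, splitTensor_tprod, splitTensor_tprod,
      permExp_innerPerm, PiTensorProduct.map_tprod, ksgn_sum]
    simp only [innerPerm_symm_apply]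
    rw [← MultilinearMap.map_smul_univ]
    congr 1
    funext a
    exact (permAct_tprod H (σ a) (fun b => ε (finProdFinEquiv (a, b))) _ fun b => hv _).symm
  | zero => simp only [map_zero]
  | add x y hx hy => simp only [map_add, hx, hy]
  | smul c x hx => simp only [map_smul, hx]

theorem splitTensor_mem (i : ZMod 2) (x : ⨂[k]^(d * n) H) (hx : x ∈ H.tpowGr (d * n) i) :
    splitTensor k H d n x ∈ (H.tpow n).tpowGr d i := by
  induction hx using Submodule.span_induction with
  | mem x h =>
    obtain ⟨ε, v, hv, rfl, rfl⟩ := h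
    rw [splitTensor_tprod, sum_finProdFinEquiv]
    exact (H.tpow n).tprod_mem_tpow _ _ (H.splitTensor_hom ε v hv)
  | zero => rw [map_zero]; exact zero_mem ((H.tpow n).tpowGr d i)
  | add x y _ _ hx hy => rw [map_add]; exact add_mem (S := Submodule k (⨂[k]^d (H.tpow n))) hx hy
  | smul c x _ hx =>
    rw [map_smul]; exact Submodule.smul_mem ((H.tpow n).tpowGr d i) c hx

end Split

/-- The tensor power of `μ`, as a bilinear map between the super vector spaces `X^{⊗n}`, `Y^{⊗n}`
and `Z^{⊗n}`. -/
noncomputable def tpowMap₂ {X Y Z : SVec k} (μ : X →ₗ[k] Y →ₗ[k] Z) (n : ℕ) :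
    X.tpow n →ₗ[k] Y.tpow n →ₗ[k] Z.tpow n := signedMap₂ μ n

/-- Cutting into blocks is compatible with the Koszul signs: composing block by block gives the
signs inside the blocks, composing the blocks those between different ones. -/
theorem splitTensor_signedMap₂ {X Y Z : SVec k} {d n : ℕ} (μ : X →ₗ[k] Y →ₗ[k] Z)
    (x : ⨂[k]^(d * n) X) (y : ⨂[k]^(d * n) Y) :
    splitTensor k Z d n (signedMap₂ μ (d * n) x y) =
      signedMap₂ (tpowMap₂ μ n) d (splitTensor k X d n x) (splitTensor k Y d n y) := by
  induction x using X.tpow_induction with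
  | zero =>
    simp only [map_zero, LinearMap.zero_apply]
    exact (LinearMap.map_zero₂ (signedMap₂ (tpowMap₂ μ n) d) _).symm
  | add x x' hx hx' =>
    simp only [map_add, LinearMap.add_apply, hx, hx']
    exact (LinearMap.map_add₂ (signedMap₂ (tpowMap₂ μ n) d) _ _ _).symm
  | smul c x hx =>
    simp only [map_smul, LinearMap.smul_apply, hx]
    exact (LinearMap.map_smul₂ (signedMap₂ (tpowMap₂ μ n) d) _ _ _).symm
  | hom ε f hf =>
    induction y using Y.tpow_induction with
    | zero =>
      simp only [map_zero]
      exact (map_zero (signedMap₂ (tpowMap₂ μ n) d _)).symm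
    | add y y' hy hy' =>
      simp only [map_add, hy, hy']
      exact (map_add (signedMap₂ (tpowMap₂ μ n) d _) _ _).symm
    | smul c y hy =>
      simp only [map_smul, hy]
      exact (map_smul (signedMap₂ (tpowMap₂ μ n) d _) _ _).symm
    | hom δ g hg =>
      rw [signedMap₂_tprod μ ε δ f g hf hg, map_smul, splitTensor_tprod, splitTensor_tprod,
        splitTensor_tprod]
      refine Eq.trans ?_ (signedMap₂_tprod (tpowMap₂ μ n) _ _ _ _ (X.splitTensor_hom ε f hf)
        (Y.splitTensor_hom δ g hg)).symm
      rw [compExp_block, ksgn_add, mul_smul, ksgn_sum]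
      congr 1
      rw [← MultilinearMap.map_smul_univ]
      congr 1
      funext a
      exact (signedMap₂_tprod μ _ _ _ _ (fun b => hf _) (fun b => hg _)).symm

end SVec

/-! ### Additive superfunctors take even values on morphisms -/

namespace GammaSV

variable {k : Type u} [Field k] {n : ℕ}

/-- The morphism `f ⊗ ⋯ ⊗ f` of `Γ^n 𝐕` given by an even linear map `f`. -/
noncomputable def powHom {V W : GammaSV k n} (f : SVec.ihom V.base.toSVec W.base.toSVec)
    (hf : f ∈ (SVec.ihom V.base.toSVec W.base.toSVec).gr 0) : V ⟶ W :=
  ⟨PiTensorProduct.tprod k fun _ => f, SVec.tprod_mem_gammaSub _ n _ hf⟩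

theorem icomp_mem_zero {U V W : SVec k} {f : SVec.ihom U V} {g : SVec.ihom V W}
    (hg : g ∈ (SVec.ihom V W).gr 0) (hf : f ∈ (SVec.ihom U V).gr 0) :
    SVec.icomp U V W g f ∈ (SVec.ihom U W).gr 0 := by
  have := SVec.comp_mem_ihom hg hf
  rwa [add_zero] at this

theorem powHom_comp {U V W : GammaSV k n} (f : SVec.ihom U.base.toSVec V.base.toSVec)
    (g : SVec.ihom V.base.toSVec W.base.toSVec)
    (hf : f ∈ (SVec.ihom U.base.toSVec V.base.toSVec).gr 0)
    (hg : g ∈ (SVec.ihom V.base.toSVec W.base.toSVec).gr 0) :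
    powHom f hf ≫ powHom g hg =
      powHom (n := n) (V := U) (W := W) (SVec.icomp _ _ _ g f) (icomp_mem_zero hg hf) := by
  have h := SVec.tcomp_tprod (n := n) (fun _ => 0) (fun _ => 0) (fun _ => g) (fun _ => f)
    (fun _ => hg) (fun _ => hf)
  rw [SVec.compExp_zero_left, SVec.ksgn_zero, one_smul] at h
  exact Subtype.ext h

theorem powHom_congr {V W : GammaSV k n} {f g : SVec.ihom V.base.toSVec W.base.toSVec}
    (h : f = g) (hf hg) : powHom (n := n) f hf = powHom g hg := by
  subst h; rfl

/-- Composition with `g ⊗ ⋯ ⊗ g` and `f ⊗ ⋯ ⊗ f`, for even `f` and `g`, is the tensor power of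
`h ↦ g ∘ h ∘ f`. -/
theorem powHom_comp_comp_val {U V W X : GammaSV k n} (f : SVec.ihom U.base.toSVec V.base.toSVec)
    (g : SVec.ihom W.base.toSVec X.base.toSVec)
    (hf : f ∈ (SVec.ihom U.base.toSVec V.base.toSVec).gr 0)
    (hg : g ∈ (SVec.ihom W.base.toSVec X.base.toSVec).gr 0) (x : V ⟶ W) :
    (powHom f hf ≫ x ≫ powHom g hg).1 =
      PiTensorProduct.map (fun _ : Fin n =>
        (SVec.icomp U.base.toSVec W.base.toSVec X.base.toSVec g) ∘ₗ
          (SVec.icomp U.base.toSVec V.base.toSVec W.base.toSVec).flip f) x.1 := by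
  have key : ∀ t : ⨂[k]^n (SVec.ihom V.base.toSVec W.base.toSVec),
      SVec.tcomp U.base.toSVec V.base.toSVec X.base.toSVec n
        (SVec.tcomp V.base.toSVec W.base.toSVec X.base.toSVec n
          (PiTensorProduct.tprod k fun _ => g) t) (PiTensorProduct.tprod k fun _ => f) =
      PiTensorProduct.map (fun _ : Fin n =>
        (SVec.icomp U.base.toSVec W.base.toSVec X.base.toSVec g) ∘ₗ
          (SVec.icomp U.base.toSVec V.base.toSVec W.base.toSVec).flip f) t := by
    intro t
    induction t using (SVec.ihom V.base.toSVec W.base.toSVec).tpow_induction with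
    | zero => simp only [map_zero, LinearMap.zero_apply]
    | add x y hx hy => simp only [map_add, LinearMap.add_apply, hx, hy]
    | smul c x hx => simp only [map_smul, LinearMap.smul_apply, hx]
    | hom ε h hh =>
      rw [SVec.tcomp_tprod (fun _ => 0) ε _ h (fun _ => hg) hh, SVec.compExp_zero_left,
        SVec.ksgn_zero, one_smul,
        SVec.tcomp_tprod (fun a => 0 + ε a) (fun _ => 0) _ _
          (fun a => SVec.comp_mem_ihom hg (hh a)) (fun _ => hf),
        SVec.compExp_zero_right, SVec.ksgn_zero, one_smul, PiTensorProduct.map_tprod]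
      rfl
  exact key x.1

end GammaSV

/-- The tensor power of a linear map of rank one has its values in a line. -/
theorem PiTensorProduct.exists_map_smulRight {k M N : Type u} [Field k] [AddCommGroup M]
    [Module k M] [AddCommGroup N] [Module k N] {n : ℕ} (l : M →ₗ[k] k) (u : N)
    (x : ⨂[k]^n M) : ∃ c : k, PiTensorProduct.map (fun _ => l.smulRight u) x =
      c • PiTensorProduct.tprod k fun _ => u := by
  induction x using PiTensorProduct.induction_on with
  | smul_tprod r f =>
    refine ⟨r * ∏ a, l (f a), ?_⟩
    rw [map_smul, PiTensorProduct.map_tprod, mul_smul, ← MultilinearMap.map_smul_univ]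
    rfl
  | add x y hx hy =>
    obtain ⟨c, hc⟩ := hx
    obtain ⟨d, hd⟩ := hy
    exact ⟨c + d, by rw [map_add, hc, hd, add_smul]⟩

namespace SVec

variable {k : Type u} [Field k]

/-- In characteristic different from `2`, the `n`-th tensor power of an odd vector is not
invariant if `2 ≤ n`, unless it vanishes: exchanging two factors changes the sign. -/
theorem smul_tprod_eq_zero_of_odd (h2 : (2 : k) ≠ 0) {n : ℕ} (hn : 2 ≤ n) (V : SVec k) (u : V)
    (hu : u ∈ V.gr 1) (c : k)
    (hc : c • PiTensorProduct.tprod k (fun _ : Fin n => u) ∈ V.gammaSub n) :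
    c • PiTensorProduct.tprod k (fun _ : Fin n => u) = 0 := by
  obtain ⟨m, rfl⟩ : ∃ m, n = m + 2 := ⟨n - 2, by omega⟩
  have h := hc (Equiv.swap 0 1)
  have hs : permExp (Equiv.swap (0 : Fin (m + 2)) 1) (fun _ => 1) = 1 := by
    have hlt : ∀ a b : Fin (m + 2), (a < b ∧ Equiv.swap (0 : Fin (m + 2)) 1 b <
        Equiv.swap (0 : Fin (m + 2)) 1 a) ↔ a = 0 ∧ b = 1 := by
      intro a b
      simp only [Equiv.swap_apply_def, Fin.ext_iff, Fin.lt_def]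
      split_ifs <;> simp_all
      omega
    simp only [permExp, hlt]
    rw [Finset.sum_eq_single 0, Finset.sum_eq_single 1] <;> simp +contextual
  have h1 : ¬ (1 : ZMod 2) = 0 := by decide
  rw [map_smul, permAct_tprod V _ (fun _ => 1) _ (fun _ => hu), hs, ksgn, if_neg h1,
    neg_one_smul, smul_neg] at h
  have h' : (2 : k) • (c • PiTensorProduct.tprod k (fun _ : Fin (m + 2) => u)) = 0 := by
    rw [two_smul]
    nth_rewrite 1 [← h]
    exact neg_add_cancel _
  exact (smul_eq_zero.1 h').resolve_left h2

/-- A finite dimensional super vector space has a basis of homogeneous vectors. -/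
theorem exists_homogeneous_basis (V : SVec k) [FiniteDimensional k V] :
    ∃ (ι : Type u) (_ : Fintype ι) (b : Module.Basis ι k V) (ε : ι → ZMod 2),
      ∀ i, b i ∈ V.gr (ε i) := by
  classical
  let b0 := Module.Basis.ofVectorSpace k (V.gr 0)
  let b1 := Module.Basis.ofVectorSpace k (V.gr 1)
  refine ⟨_ ⊕ _, inferInstance,
    (b0.prod b1).map (Submodule.prodEquivOfIsCompl _ _ V.isCompl),
    Sum.elim (fun _ => 0) (fun _ => 1), ?_⟩
  rintro (i | i)
  · simp
  · simp

theorem coord_eq_zero_of_mem {V : SVec k} {ι : Type u} [Fintype ι] (b : Module.Basis ι k V)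
    (ε : ι → ZMod 2) (hb : ∀ i, b i ∈ V.gr (ε i)) {i : ι} {j : ZMod 2} (hij : ε i ≠ j) {v : V}
    (hv : v ∈ V.gr j) : b.coord i v = 0 := by
  classical
  have h : v = ∑ l, b.repr v l • V.proj j (b l) := by
    have hp : V.proj j v = v := by rw [V.proj_of_mem j j v hv, if_pos rfl]
    conv_lhs => rw [← hp, ← b.sum_repr v, map_sum]
    simp only [map_smul]
  rw [h, map_sum]
  refine Finset.sum_eq_zero fun l _ => ?_
  rw [map_smul, V.proj_of_mem j _ _ (hb l)]
  split_ifs with hl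
  · have : l ≠ i := by
      rintro rfl
      exact hij hl.symm
    simp [this]
  · simp

/-- The identity of a finite dimensional super vector space is the sum of the even projections on
the lines spanned by the vectors of a homogeneous basis. -/
theorem exists_homogeneous_rank_one_sum_eq_iid (V : SVec k) [FiniteDimensional k V] :
    ∃ (ι : Type u) (_ : Fintype ι) (l : ι → V →ₗ[k] k) (b : ι → V) (ε : ι → ZMod 2)
      (P : ι → ihom V V), (∀ i, P i = (l i).smulRight (b i)) ∧ (∀ i, b i ∈ V.gr (ε i)) ∧
      (∀ i j, ε i ≠ j → ∀ v ∈ V.gr j, l i v = 0) ∧ (∀ i, P i ∈ (ihom V V).gr 0) ∧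
      ∑ i, P i = iid V := by
  obtain ⟨ι, _, b, ε, hb⟩ := V.exists_homogeneous_basis
  have hl : ∀ i j, ε i ≠ j → ∀ v ∈ V.gr j, b.coord i v = 0 :=
    fun i j hij v hv => coord_eq_zero_of_mem b ε hb hij hv
  refine ⟨ι, inferInstance, b.coord, b, ε, fun i => (b.coord i).smulRight (b i), fun _ => rfl, hb,
    hl, fun i j v hv => ?_, ?_⟩
  · rw [zero_add, LinearMap.smulRight_apply]
    by_cases h : ε i = j
    · subst h
      exact Submodule.smul_mem _ _ (hb i)
    · rw [hl i j h v hv, zero_smul]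
      exact zero_mem _
  · refine LinearMap.ext fun v => Eq.trans (LinearMap.sum_apply _ _ _) ?_
    exact b.sum_repr v

end SVec

namespace Superfunctor

variable {k : Type u} [Field k] {n : ℕ} (A : Superfunctor k n)

open GammaSV in
theorem map_powHom_zero (hn : 0 < n) (V W : GammaSV k n) :
    A.functor.map (powHom (n := n) (V := V) (W := W) 0 (zero_mem _)) = 0 := by
  have h : powHom (n := n) (V := V) (W := W) 0 (zero_mem _) = 0 :=
    Subtype.ext (MultilinearMap.map_coord_zero _ ⟨0, hn⟩ rfl)
  have h0 := A.isSuperlinear.map_smul (X := V) (Y := W) (0 : k) 0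
  rw [zero_smul, zero_smul] at h0
  rw [h, h0]

open GammaSV in
/-- An additive superfunctor is additive on the morphisms `f ⊗ ⋯ ⊗ f`. -/
theorem map_powHom_add (hn : 0 < n) (hA : A.IsAdditive) {V W : GammaSV k n}
    (f g : SVec.ihom V.base.toSVec W.base.toSVec)
    (hf : f ∈ (SVec.ihom V.base.toSVec W.base.toSVec).gr 0)
    (hg : g ∈ (SVec.ihom V.base.toSVec W.base.toSVec).gr 0) :
    A.functor.map (powHom (f + g) (add_mem hf hg)) =
      A.functor.map (powHom f hf) + A.functor.map (powHom g hg) := by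
  let V' := V.base.toSVec
  let W' := W.base.toSVec
  -- `f + g` is the diagonal `Δ` followed by the map `s = (f, g)` on `V ⊕ V`.
  let Δ : V ⟶ V.prod V := powHom (n := n) (V := V) (W := V.prod V)
    (LinearMap.prod LinearMap.id LinearMap.id : V' →ₗ[k] V' × V')
    (fun j v hv => by rw [zero_add]; exact ⟨hv, hv⟩)
  have hs : (LinearMap.coprod f g : V' × V' →ₗ[k] W') ∈ (SVec.ihom (V'.prod V') W').gr 0 :=
    fun j v hv => by
      exact add_mem (hf j _ hv.1) (hg j _ hv.2)
  let s : V.prod V ⟶ W := powHom (n := n) (V := V.prod V) (W := W)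
    (LinearMap.coprod f g : V' × V' →ₗ[k] W') hs
  let e₁ : V.prod V ⟶ V := powHom (n := n) (V := V.prod V) (W := V)
    (LinearMap.fst k V' V') (fun j v hv => by rw [zero_add]; exact hv.1)
  let e₂ : V.prod V ⟶ V := powHom (n := n) (V := V.prod V) (W := V)
    (LinearMap.snd k V' V') (fun j v hv => by rw [zero_add]; exact hv.2)
  have hΔs : Δ ≫ s = powHom (f + g) (add_mem hf hg) :=
    (powHom_comp (n := n) (U := V) (V := V.prod V) (W := W) _ _ _ _).trans (powHom_congr rfl _ _)
  have hl : GammaSV.inl V V ≫ s = powHom f hf :=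
    (powHom_comp (n := n) (U := V) (V := V.prod V) (W := W) _ _ (SVec.inl_mem_ihom _ _) _).trans
      (powHom_congr (LinearMap.coprod_inl f g) _ _)
  have hr : GammaSV.inr V V ≫ s = powHom g hg :=
    (powHom_comp (n := n) (U := V) (V := V.prod V) (W := W) _ _ (SVec.inr_mem_ihom _ _) _).trans
      (powHom_congr (LinearMap.coprod_inr f g) _ _)
  have h1 : Δ ≫ e₁ = 𝟙 V :=
    powHom_comp (n := n) (U := V) (V := V.prod V) (W := V) _ _ _ _
  have h2 : Δ ≫ e₂ = 𝟙 V :=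
    powHom_comp (n := n) (U := V) (V := V.prod V) (W := V) _ _ _ _
  have hl1 : GammaSV.inl V V ≫ e₁ = 𝟙 V :=
    powHom_comp (n := n) (U := V) (V := V.prod V) (W := V) _ _ (SVec.inl_mem_ihom _ _) _
  have hr2 : GammaSV.inr V V ≫ e₂ = 𝟙 V :=
    powHom_comp (n := n) (U := V) (V := V.prod V) (W := V) _ _ (SVec.inr_mem_ihom _ _) _
  have hl2 : GammaSV.inl V V ≫ e₂ = powHom 0 (zero_mem _) :=
    (powHom_comp (n := n) (U := V) (V := V.prod V) (W := V) _ _ (SVec.inl_mem_ihom _ _) _).trans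
      (powHom_congr (LinearMap.snd_comp_inl k V' V') _ _)
  have hr1 : GammaSV.inr V V ≫ e₁ = powHom 0 (zero_mem _) :=
    (powHom_comp (n := n) (U := V) (V := V.prod V) (W := V) _ _ (SVec.inr_mem_ihom _ _) _).trans
      (powHom_congr (LinearMap.fst_comp_inr k V' V') _ _)
  have app : ∀ {X Y Z : GammaSV k n} (a : X ⟶ Y) (b : Y ⟶ Z) (v : A.functor.obj X),
      SVec.toLin (A.functor.map b) (SVec.toLin (A.functor.map a) v) =
        SVec.toLin (A.functor.map (a ≫ b)) v := fun a b v => by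
    rw [A.functor.map_comp]; rfl
  have one : ∀ (X : GammaSV k n) (v : A.functor.obj X),
      SVec.toLin (A.functor.map (𝟙 X)) v = v := fun X v => by
    rw [A.functor.map_id]; rfl
  have zero : ∀ (X Y : GammaSV k n) (v : A.functor.obj X),
      SVec.toLin (A.functor.map (powHom (n := n) (V := X) (W := Y) 0 (zero_mem _))) v = 0 :=
    fun X Y v => by rw [A.map_powHom_zero hn]; rfl
  refine LinearMap.ext fun v => ?_
  obtain ⟨⟨a, b⟩, hab⟩ := (hA V V).2 (SVec.toLin (A.functor.map Δ) v)
  simp only at hab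
  have ha : a = v := by
    have := congrArg (SVec.toLin (A.functor.map e₁)) hab
    rwa [map_add, app, app, app, hl1, hr1, h1, one, one, zero, add_zero] at this
  have hb : b = v := by
    have := congrArg (SVec.toLin (A.functor.map e₂)) hab
    rwa [map_add, app, app, app, hl2, hr2, h2, one, one, zero, zero_add] at this
  have := congrArg (SVec.toLin (A.functor.map s)) hab
  rw [map_add, app, app, app, hl, hr, hΔs, ha, hb] at this
  exact this.symm

open GammaSV in
theorem map_powHom_sum (hn : 0 < n) (hA : A.IsAdditive) {V W : GammaSV k n} {ι : Type*}
    (s : Finset ι) (f : ι → SVec.ihom V.base.toSVec W.base.toSVec)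
    (hf : ∀ i, f i ∈ (SVec.ihom V.base.toSVec W.base.toSVec).gr 0) :
    A.functor.map (powHom (∑ i ∈ s, f i) (sum_mem fun i _ => hf i)) =
      ∑ i ∈ s, A.functor.map (powHom (f i) (hf i)) := by
  classical
  induction s using Finset.induction_on with
  | empty => exact A.map_powHom_zero hn V W
  | insert a s ha ih =>
    have h : ∑ i ∈ insert a s, A.functor.map (powHom (f i) (hf i)) =
        A.functor.map (powHom (f a) (hf a)) + ∑ i ∈ s, A.functor.map (powHom (f i) (hf i)) :=
      Finset.sum_insert ha
    rw [h, ← ih, ← A.map_powHom_add hn hA]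
    exact congrArg _ (powHom_congr (Finset.sum_insert ha) _ _)

open GammaSV in
theorem sum_map_powHom_eq_id (hn : 0 < n) (hA : A.IsAdditive) {V : GammaSV k n} {ι : Type*}
    [Fintype ι] (P : ι → SVec.ihom V.base.toSVec V.base.toSVec)
    (hP : ∀ i, P i ∈ (SVec.ihom V.base.toSVec V.base.toSVec).gr 0)
    (hs : ∑ i, P i = SVec.iid V.base.toSVec) :
    ∑ i, A.functor.map (powHom (P i) (hP i)) = 𝟙 (A.functor.obj V) := by
  rw [← A.map_powHom_sum hn hA, ← A.functor.map_id]
  exact congrArg _ (powHom_congr (n := n) hs _ (SVec.id_mem_ihom _))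

/-- `A` sends every morphism, whatever its parity, to an even one. -/
def MapsToEven : Prop := ∀ (V W : GammaSV k n) (f : V ⟶ W),
  A.functor.map f ∈ Superlinear.homGr (k := k) (A.functor.obj V) (A.functor.obj W) 0

variable {A} in
/-- An additive superfunctor of degree at least `2` maps every morphism to an even one. Cutting
`V` and `W` into homogeneous lines reduces this to a line of maps of rank one. If these are
even, so are their tensor powers; if they are odd, their tensor powers are not invariant. -/
theorem IsAdditive.mapsToEven (h2 : (2 : k) ≠ 0) (hn : 2 ≤ n) (hA : A.IsAdditive) :
    A.MapsToEven := by
  intro V W f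
  have := V.base.finite
  have := W.base.finite
  obtain ⟨ι, _, l, b, ε, P, hPdef, hb, hl, hP, hPs⟩ :=
    V.base.toSVec.exists_homogeneous_rank_one_sum_eq_iid
  obtain ⟨κ, _, m, c, δ, Q, hQdef, hc, -, hQ, hQs⟩ :=
    W.base.toSVec.exists_homogeneous_rank_one_sum_eq_iid
  have hf : A.functor.map f = ∑ i, ∑ j, A.functor.map
      (GammaSV.powHom (P i) (hP i) ≫ f ≫ GammaSV.powHom (Q j) (hQ j)) := by
    calc A.functor.map f = 𝟙 _ ≫ A.functor.map f ≫ 𝟙 _ := by simp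
      _ = _ := by
        rw [← A.sum_map_powHom_eq_id (by omega) hA P hP hPs,
          ← A.sum_map_powHom_eq_id (by omega) hA Q hQ hQs]
        simp only [Preadditive.sum_comp, Preadditive.comp_sum, Functor.map_comp]
        exact Finset.sum_comm
  rw [hf]
  refine sum_mem fun i _ => sum_mem fun j _ => A.isSuperlinear.map_mem 0 _ ?_
  -- The map `h ↦ Q j ∘ h ∘ P i` has its values in the line spanned by `u`.
  let u : SVec.ihom V.base.toSVec W.base.toSVec := (l i).smulRight (c j)
  have hu : u ∈ (SVec.ihom V.base.toSVec W.base.toSVec).gr (ε i + δ j) := by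
    intro a v hv
    change l i v • c j ∈ _
    by_cases h : ε i = a
    · subst h
      have two : ∀ x y : ZMod 2, x + y + x = y := by decide
      rw [two]
      exact Submodule.smul_mem _ _ (hc j)
    · rw [hl i a h v hv, zero_smul]
      exact zero_mem _
  let L : (SVec.ihom V.base.toSVec W.base.toSVec).carrier →ₗ[k] k :=
    m j ∘ₗ (LinearMap.applyₗ (b i) : (V.base.toSVec →ₗ[k] W.base.toSVec) →ₗ[k] W.base.toSVec)
  have hL : SVec.icomp V.base.toSVec W.base.toSVec W.base.toSVec (Q j) ∘ₗ
      (SVec.icomp V.base.toSVec V.base.toSVec W.base.toSVec).flip (P i) = L.smulRight u := by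
    refine LinearMap.ext fun h => LinearMap.ext fun v => ?_
    rw [hPdef, hQdef]
    let h' : V.base.toSVec →ₗ[k] W.base.toSVec := h
    change m j (h' (l i v • b i)) • c j = m j (h' (b i)) • l i v • c j
    rw [map_smul, map_smul, smul_eq_mul, mul_comm, mul_smul]
  obtain ⟨t, ht⟩ := PiTensorProduct.exists_map_smulRight L u f.1
  have hval : (GammaSV.powHom (P i) (hP i) ≫ f ≫ GammaSV.powHom (Q j) (hQ j)).1 =
      t • PiTensorProduct.tprod k fun _ => u := by
    rw [GammaSV.powHom_comp_comp_val, hL]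
    exact ht
  have hmem := (GammaSV.powHom (P i) (hP i) ≫ f ≫ GammaSV.powHom (Q j) (hQ j)).2
  change (GammaSV.powHom (P i) (hP i) ≫ f ≫ GammaSV.powHom (Q j) (hQ j)).1 ∈
    (SVec.ihom V.base.toSVec W.base.toSVec).tpowGr n 0
  rw [hval] at hmem ⊢
  have par : ∀ x : ZMod 2, x = 0 ∨ x = 1 := by decide
  rcases par (ε i + δ j) with h | h
  · rw [h] at hu
    exact Submodule.smul_mem _ _ (SVec.tprod_mem_tpowGr _ n u hu)
  · rw [h] at hu
    rw [SVec.smul_tprod_eq_zero_of_odd h2 hn _ u hu t hmem]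
    exact zero_mem _

/-- The factorization of `A` through the even maps. -/
def toEv (he : A.MapsToEven) :
    GammaSV k n ⥤ Ev k (SVec k) where
  obj V := ⟨A.functor.obj V⟩
  map f := ⟨A.functor.map f, he _ _ f⟩
  map_id V := Subtype.ext (A.functor.map_id V)
  map_comp f g := Subtype.ext (A.functor.map_comp f g)

theorem isSuperlinear_toEv (he : A.MapsToEven) :
    IsSuperlinear k (A.toEv he) where
  map_add f g := Subtype.ext (A.isSuperlinear.map_add f g)
  map_smul c f := Subtype.ext (A.isSuperlinear.map_smul c f)
  map_mem {V W} i f hf := by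
    have par : ∀ x : ZMod 2, x = 0 ∨ x = 1 := by decide
    rcases par i with rfl | rfl
    · change _ ∈ if (0 : ZMod 2) = 0 then _ else _
      rw [if_pos rfl]
      exact Submodule.mem_top
    · have h : (A.toEv he).map f = 0 := Subtype.ext ((Submodule.disjoint_def.1
        (Superlinear.isCompl_homGr (k := k) (A.functor.obj V) (A.functor.obj W)).disjoint) _
        (he V W f) (A.isSuperlinear.map_mem 1 f hf))
      rw [h]
      exact zero_mem _

theorem toEv_comp_incl (he : A.MapsToEven) :
    A.toEv he ⋙ Ev.incl k (SVec k) = A.functor := rfl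

end Superfunctor

/-! ### Tensors whose factors lie in a fixed space -/

section FixedTensors

variable {k M : Type u} [Field k] [AddCommGroup M] [Module k M]

/-- If `S` contains the common fixed space of the `T i`, the identity is the sum of a map with
values in `S` and of a combination of the `T i - 1`. -/
theorem Submodule.exists_id_eq_of_fixed {ι : Type*} [Fintype ι] (S : Submodule k M)
    (T : ι → M →ₗ[k] M) (hS : ∀ x, (∀ i, T i x = x) → x ∈ S) :
    ∃ (π : M →ₗ[k] S) (R : ι → M →ₗ[k] M),
      LinearMap.id = S.subtype ∘ₗ π + ∑ i, R i ∘ₗ (T i - LinearMap.id) := by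
  classical
  obtain ⟨π, hπ⟩ := S.subtype.exists_leftInverse_of_injective S.ker_subtype
  let L : M →ₗ[k] (ι → M) := LinearMap.pi fun i => T i - LinearMap.id
  let g : M →ₗ[k] M := LinearMap.id - S.subtype ∘ₗ π
  have hg : LinearMap.ker L ≤ LinearMap.ker g := by
    intro x hx
    have hxS : x ∈ S := hS x fun i => by
      have := congrFun (LinearMap.mem_ker.1 hx) i
      exact sub_eq_zero.1 this
    have := LinearMap.congr_fun hπ ⟨x, hxS⟩
    have h' : π x = ⟨x, hxS⟩ := this
    simp [g, h']
  -- `g` factors through `L` because its kernel contains that of `L`.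
  obtain ⟨R, hR⟩ := LinearMap.exists_extend
    ((LinearMap.ker L).liftQ g hg ∘ₗ L.quotKerEquivRange.symm.toLinearMap)
  have hRL : R ∘ₗ L = g := by
    refine LinearMap.ext fun x => ?_
    have h := LinearMap.congr_fun hR (L.rangeRestrict x)
    have hx : L.quotKerEquivRange.symm (L.rangeRestrict x) = Submodule.Quotient.mk x := by
      rw [LinearEquiv.symm_apply_eq]
      rfl
    simp only [LinearMap.comp_apply, LinearEquiv.coe_coe, hx] at h
    exact h
  refine ⟨π, fun i => R ∘ₗ LinearMap.single k (fun _ => M) i, LinearMap.ext fun x => ?_⟩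
  have h := LinearMap.congr_fun hRL x
  have hL : L x = ∑ i, LinearMap.single k (fun _ => M) i (T i x - x) := by
    rw [← LinearMap.sum_single_apply (fun _ => M) (L x)]
    rfl
  rw [LinearMap.comp_apply, hL, map_sum] at h
  simp only [LinearMap.add_apply, LinearMap.sum_apply, LinearMap.comp_apply, LinearMap.sub_apply,
    LinearMap.id_apply] at h ⊢
  rw [h]
  simp [g]

/-- The endomorphism `f` in the factor `a`, as a linear function of `f`. -/
noncomputable def PiTensorProduct.mapAt (k M : Type u) [Field k] [AddCommGroup M] [Module k M]
    {d : ℕ} (a : Fin d) : (M →ₗ[k] M) →ₗ[k] (⨂[k]^d M) →ₗ[k] (⨂[k]^d M) :=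
  (PiTensorProduct.mapMultilinear k (fun _ : Fin d => M) (fun _ => M)).toLinearMap
    (fun _ => LinearMap.id) a

theorem PiTensorProduct.mapAt_apply {d : ℕ} (a : Fin d) (f : M →ₗ[k] M) :
    PiTensorProduct.mapAt k M a f =
      PiTensorProduct.map (Function.update (fun _ => LinearMap.id) a f) := rfl

theorem PiTensorProduct.mapAt_comp {d : ℕ} (a : Fin d) (f g : M →ₗ[k] M) :
    PiTensorProduct.mapAt k M a (f ∘ₗ g) =
      PiTensorProduct.mapAt k M a f ∘ₗ PiTensorProduct.mapAt k M a g := by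
  simp only [PiTensorProduct.mapAt_apply]
  rw [← PiTensorProduct.map_comp]
  congr 1
  funext b
  by_cases h : b = a
  · subst h; simp
  · simp [h]

theorem PiTensorProduct.mapAt_id {d : ℕ} (a : Fin d) :
    PiTensorProduct.mapAt k M a LinearMap.id = (LinearMap.id : (⨂[k]^d M) →ₗ[k] _) := by
  rw [PiTensorProduct.mapAt_apply, Function.update_eq_self_iff.2 rfl]
  exact PiTensorProduct.map_id

/-- If `S` contains the common fixed space of the `T i`, then the tensors fixed by every `T i` in every
factor belong to `S^{⊗d}`. -/
theorem PiTensorProduct.exists_map_subtype_eq {ι : Type*} [Fintype ι] (S : Submodule k M)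
    (T : ι → M →ₗ[k] M) (hS : ∀ x, (∀ i, T i x = x) → x ∈ S) {d : ℕ} (x : ⨂[k]^d M)
    (hx : ∀ (a : Fin d) i, PiTensorProduct.mapAt k M a (T i) x = x) :
    ∃ z : ⨂[k]^d S, PiTensorProduct.map (fun _ => S.subtype) z = x := by
  classical
  obtain ⟨π, R, hR⟩ := S.exists_id_eq_of_fixed T hS
  have hfix : ∀ a : Fin d, PiTensorProduct.mapAt k M a (S.subtype ∘ₗ π) x = x := by
    intro a
    have h0 : ∀ i, PiTensorProduct.mapAt k M a (R i ∘ₗ (T i - LinearMap.id)) x = 0 := fun i => by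
      rw [PiTensorProduct.mapAt_comp, LinearMap.comp_apply, map_sub, LinearMap.sub_apply, hx,
        PiTensorProduct.mapAt_id, LinearMap.id_apply, sub_self, map_zero]
    have h := congrArg (fun f => PiTensorProduct.mapAt k M a f x) hR
    simp only [map_add, map_sum, PiTensorProduct.mapAt_id, LinearMap.add_apply,
      LinearMap.sum_apply, h0, LinearMap.id_apply, Finset.sum_const_zero, add_zero] at h
    exact h.symm
  refine ⟨PiTensorProduct.map (fun _ => π) x, ?_⟩
  rw [← LinearMap.comp_apply, ← PiTensorProduct.map_comp]
  have key : ∀ s : Finset (Fin d), PiTensorProduct.map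
      (fun a => if a ∈ s then S.subtype ∘ₗ π else LinearMap.id) x = x := by
    intro s
    induction s using Finset.induction_on with
    | empty =>
      simp only [Finset.notMem_empty, if_false]
      exact LinearMap.congr_fun PiTensorProduct.map_id x
    | insert a s ha ih =>
      have : PiTensorProduct.map
          (fun b => if b ∈ insert a s then S.subtype ∘ₗ π else LinearMap.id) =
          PiTensorProduct.mapAt k M a (S.subtype ∘ₗ π) ∘ₗ
            PiTensorProduct.map (fun b => if b ∈ s then S.subtype ∘ₗ π else LinearMap.id) := by
        rw [PiTensorProduct.mapAt_apply, ← PiTensorProduct.map_comp]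
        congr 1
        funext b
        by_cases h : b = a
        · subst h; simp [ha]
        · simp [h]
      rw [this, LinearMap.comp_apply, ih, hfix]
  simpa using key Finset.univ

theorem PiTensorProduct.map_subtype_injective (S : Submodule k M) (d : ℕ) :
    Function.Injective (PiTensorProduct.map (fun _ : Fin d => S.subtype)) := by
  obtain ⟨π, hπ⟩ := S.subtype.exists_leftInverse_of_injective S.ker_subtype
  refine Function.LeftInverse.injective (g := PiTensorProduct.map fun _ => π) fun x => ?_
  rw [← LinearMap.comp_apply, ← PiTensorProduct.map_comp]
  simp only [hπ]
  exact LinearMap.congr_fun PiTensorProduct.map_id x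

end FixedTensors

namespace SVec

variable {k : Type u} [Field k]

theorem permAct_one (V : SVec k) {n : ℕ} : V.permAct (1 : Equiv.Perm (Fin n)) = LinearMap.id := by
  refine V.tpow_ext fun ε v hv => ?_
  rw [permAct_tprod V 1 ε v hv]
  have : permExp (1 : Equiv.Perm (Fin n)) ε = 0 := by
    refine Finset.sum_eq_zero fun a _ => Finset.sum_eq_zero fun b _ => if_neg ?_
    rintro ⟨h, h'⟩
    exact h.not_gt h'
  rw [this, ksgn_zero, one_smul]
  rfl

/-- The inclusion `Γ^{d*n} H → Γ^d (Γ^n H)`. -/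
theorem exists_gamma_splitTensor (H : SVec k) {d n : ℕ} (x : H.gamma (d * n)) :
    ∃ z : (H.gamma n).gamma d,
      PiTensorProduct.map (fun _ => (H.gammaSub n).subtype) z.1 = splitTensor k H d n x.1 := by
  have hin : ∀ (a : Fin d) (σ : Equiv.Perm (Fin n)), PiTensorProduct.mapAt k (⨂[k]^n H) a
      (H.permAct σ) (splitTensor k H d n x.1) = splitTensor k H d n x.1 := by
    intro a σ
    conv_rhs => rw [← x.2 (innerPerm (Function.update (fun _ => 1) a σ)),
      splitTensor_permAct_innerPerm]
    rw [PiTensorProduct.mapAt_apply]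
    congr 2
    funext b
    by_cases h : b = a
    · subst h; simp
    · simp [h, permAct_one]
  obtain ⟨z, hz⟩ := PiTensorProduct.exists_map_subtype_eq (H.gammaSub n)
    (fun σ : Equiv.Perm (Fin n) => H.permAct σ) (fun _ h => h) (splitTensor k H d n x.1) hin
  refine ⟨⟨z, fun τ => PiTensorProduct.map_subtype_injective (H.gammaSub n) d ?_⟩, hz⟩
  have h := permAct_map (X := H.gamma n) (Y := H.tpow n) (H.gammaSub n).subtype
    (fun _ _ h => h) τ z
  refine h.symm.trans (Eq.trans ?_ hz.symm)
  refine (congrArg ((H.tpow n).permAct τ) hz).trans ?_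
  rw [← splitTensor_permAct_blockPerm, x.2]

/-- A tensor of `Γ^d (Γ^n H)` coming from an odd one of `Γ^{d*n} H` has no component all of whose
factors are even. -/
theorem parityProj_zero_of_splitTensor_odd (H : SVec k) {d n : ℕ} (x : ⨂[k]^(d * n) H)
    (hx : x ∈ H.tpowGr (d * n) 1) (z : ⨂[k]^d (H.gamma n))
    (hz : PiTensorProduct.map (fun _ => (H.gammaSub n).subtype) z = splitTensor k H d n x) :
    (H.gamma n).parityProj 0 z = 0 := by
  refine PiTensorProduct.map_subtype_injective (H.gammaSub n) d ?_
  have h := parityProj_map (X := H.gamma n) (Y := H.tpow n) (H.gammaSub n).subtype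
    (fun _ _ h => h) 0 z
  refine h.symm.trans (Eq.trans ?_ (map_zero _).symm)
  refine (congrArg ((H.tpow n).parityProj 0) hz).trans ?_
  exact parityProj_zero_of_mem_one (H.tpow n) (splitTensor_mem H 1 x hx)

end SVec

/-! ### The functor `Γ^{d*n} 𝐕 ⥤ Γ^d 𝒱` induced by a superfunctor with even values -/

namespace Superfunctor

variable {k : Type u} [Field k] {n : ℕ} {A : Superfunctor k n}

theorem mapLin_mem (V W : FinSVec k) (j : ZMod 2) (f : GammaSV.homSVec n V W)
    (hf : f ∈ (GammaSV.homSVec n V W).gr j) :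
    A.mapLin V W f ∈ (SVec.ihom (A.functor.obj ⟨V⟩) (A.functor.obj ⟨W⟩)).gr j :=
  A.isSuperlinear.map_mem (X := ⟨V⟩) (Y := ⟨W⟩) j f hf

theorem MapsToEven.parityProj_map (he : A.MapsToEven) {d : ℕ} {V W : FinSVec k}
    (z : ⨂[k]^d (GammaSV.homSVec n V W)) (ε : Fin d → ZMod 2) :
    (SVec.ihom (A.functor.obj ⟨V⟩) (A.functor.obj ⟨W⟩)).parityProj ε
        (PiTensorProduct.map (fun _ => A.mapLin V W) z) =
      if ε = 0 then PiTensorProduct.map (fun _ => A.mapLin V W) z else 0 := by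
  rw [SVec.parityProj_map _ (mapLin_mem V W),
    SVec.map_parityProj_of_forall_even _ (mapLin_mem V W) fun f => he ⟨V⟩ ⟨W⟩ f]

variable (hA : A.HasFiniteValues) {d : ℕ}

theorem MapsToEven.exists_gammaMap (he : A.MapsToEven) {V W : FinSVec k}
    (x : (⟨V⟩ : GammaSV k (d * n)) ⟶ ⟨W⟩) : ∃ y, A.GammaMap hA d x y := by
  obtain ⟨z, hz⟩ := (SVec.ihom V.toSVec W.toSVec).exists_gamma_splitTensor (d := d) (n := n) x
  refine ⟨⟨PiTensorProduct.map (fun _ => A.mapLin V W) z.1, fun σ => ?_⟩, z, hz, rfl⟩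
  -- The signed and the unsigned actions agree on tensors with even factors.
  have h := SVec.permAct_eq_reindex (X := SVec.ihom (A.functor.obj ⟨V⟩) (A.functor.obj ⟨W⟩)) σ
    (PiTensorProduct.map (fun _ => A.mapLin V W) z.1)
    fun ε hε => by rw [he.parityProj_map, if_neg hε]
  refine h.symm.trans ?_
  rw [SVec.permAct_map _ (mapLin_mem V W), z.2]

variable {hA}

/-- The relation is functional, since tensor powers preserve the injectivity of
`Γ^n Hom(V,W) → Hom(V,W)^{⊗n}`. -/
theorem GammaMap.unique {V W : FinSVec k} {x : (⟨V⟩ : GammaSV k (d * n)) ⟶ ⟨W⟩} {y y'}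
    (h : A.GammaMap hA d x y) (h' : A.GammaMap hA d x y') : y = y' := by
  obtain ⟨z, hz, hy⟩ := h
  obtain ⟨z', hz', hy'⟩ := h'
  have : z.1 = z'.1 := PiTensorProduct.map_subtype_injective _ d (hz.trans hz'.symm)
  exact Subtype.ext (hy.symm.trans ((congrArg _ this).trans hy'))

theorem GammaMap.add {V W : FinSVec k} {x x' : (⟨V⟩ : GammaSV k (d * n)) ⟶ ⟨W⟩} {y y'}
    (h : A.GammaMap hA d x y) (h' : A.GammaMap hA d x' y') :
    A.GammaMap hA d (x + x') (y + y') := by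
  obtain ⟨z, hz, hy⟩ := h
  obtain ⟨z', hz', hy'⟩ := h'
  refine ⟨z + z', ?_, ?_⟩
  · refine (map_add _ z.1 z'.1).trans ((congrArg₂ (· + ·) hz hz').trans ?_)
    exact (map_add (splitTensor k _ d n) x.1 x'.1).symm
  · exact (map_add _ z.1 z'.1).trans (congrArg₂ (· + ·) hy hy')

theorem GammaMap.smul {V W : FinSVec k} (c : k) {x : (⟨V⟩ : GammaSV k (d * n)) ⟶ ⟨W⟩} {y}
    (h : A.GammaMap hA d x y) : A.GammaMap hA d (c • x) (c • y) := by
  obtain ⟨z, hz, hy⟩ := h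
  refine ⟨c • z, ?_, ?_⟩
  · refine (map_smul _ c z.1).trans ((congrArg (c • ·) hz).trans ?_)
    exact (map_smul (splitTensor k _ d n) c x.1).symm
  · exact (map_smul _ c z.1).trans (congrArg (c • ·) hy)

theorem GammaMap.id (V : FinSVec k) :
    A.GammaMap hA d (𝟙 (⟨V⟩ : GammaSV k (d * n))) (𝟙 (GammaV.ofSVec d (A.fobj hA V))) := by
  refine ⟨⟨PiTensorProduct.tprod k fun _ => 𝟙 (⟨V⟩ : GammaSV k n),
    SVec.tprod_mem_gammaSub _ d _ (Superlinear.id_mem (k := k) (⟨V⟩ : GammaSV k n))⟩, ?_, ?_⟩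
  · refine (PiTensorProduct.map_tprod
      (fun _ => ((SVec.ihom V.toSVec V.toSVec).gammaSub n).subtype) _).trans ?_
    exact (splitTensor_tprod k (SVec.ihom V.toSVec V.toSVec) d n fun _ => SVec.iid V.toSVec).symm
  · refine (PiTensorProduct.map_tprod (fun _ => A.mapLin V V) _).trans ?_
    have h : A.mapLin V V (𝟙 (⟨V⟩ : GammaSV k n)) = 𝟙 (A.functor.obj ⟨V⟩) :=
      A.functor.map_id _
    exact congrArg _ (funext fun _ => h)

/-- The composition of `Γ^n 𝐕`, as a bilinear map. -/
noncomputable def gammaComp (U V W : FinSVec k) :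
    GammaSV.homSVec n V W →ₗ[k] GammaSV.homSVec n U V →ₗ[k] GammaSV.homSVec n U W :=
  LinearMap.mk₂ k (fun g f => (⟨SVec.tcomp _ _ _ n g.1 f.1, SVec.tcomp_mem_gammaSub g.2 f.2⟩ :
      (SVec.ihom U.toSVec W.toSVec).gammaSub n))
    (fun g g' f => Subtype.ext (LinearMap.map_add₂ (SVec.tcomp _ _ _ n) g.1 g'.1 f.1))
    (fun c g f => Subtype.ext (LinearMap.map_smul₂ (SVec.tcomp _ _ _ n) c g.1 f.1))
    (fun g f f' => Subtype.ext (map_add (SVec.tcomp _ _ _ n g.1) f.1 f'.1))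
    (fun c g f => Subtype.ext (map_smul (SVec.tcomp _ _ _ n g.1) c f.1))

/-- The Koszul signs of the composition disappear under `A`, which kills odd morphisms. -/
theorem GammaMap.comp (he : A.MapsToEven) {U V W : FinSVec k}
    {x : (⟨U⟩ : GammaSV k (d * n)) ⟶ ⟨V⟩} {x' : (⟨V⟩ : GammaSV k (d * n)) ⟶ ⟨W⟩} {y y'}
    (h : A.GammaMap hA d x y) (h' : A.GammaMap hA d x' y') :
    A.GammaMap hA d (x ≫ x') (y ≫ y') := by
  obtain ⟨y'', h''⟩ := he.exists_gammaMap hA (x ≫ x')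
  suffices y'' = y ≫ y' from this ▸ h''
  obtain ⟨z, hz, hy⟩ := h
  obtain ⟨z', hz', hy'⟩ := h'
  obtain ⟨z'', hz'', hy''⟩ := h''
  have hcomp : z''.1 = SVec.signedMap₂ (gammaComp U V W) d z'.1 z.1 := by
    refine PiTensorProduct.map_subtype_injective _ d (hz''.trans ?_)
    have h1 := SVec.splitTensor_signedMap₂ (d := d) (n := n)
      (SVec.icomp U.toSVec V.toSVec W.toSVec) x'.1 x.1
    have h2 := SVec.map_signedMap₂ (X := GammaSV.homSVec n V W) (Y := GammaSV.homSVec n U V)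
      (Z := GammaSV.homSVec n U W) (X' := (SVec.ihom V.toSVec W.toSVec).tpow n)
      (Y' := (SVec.ihom U.toSVec V.toSVec).tpow n) (Z' := (SVec.ihom U.toSVec W.toSVec).tpow n)
      (gammaComp U V W) (SVec.tpowMap₂ (SVec.icomp U.toSVec V.toSVec W.toSVec) n)
      (Submodule.subtype _) (Submodule.subtype _) (Submodule.subtype _) (fun _ _ h => h)
      (fun _ _ h => h) (fun _ _ => rfl) z'.1 z.1
    refine h1.trans (Eq.trans ?_ h2.symm)
    exact (congrArg₂ (fun a b => SVec.signedMap₂ _ d a b) hz' hz).symm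
  have hmap := SVec.map_signedMap₂ (gammaComp U V W)
    (SVec.icomp (A.functor.obj ⟨U⟩) (A.functor.obj ⟨V⟩) (A.functor.obj ⟨W⟩))
    (A.mapLin V W) (A.mapLin U V) (A.mapLin U W) (mapLin_mem V W) (mapLin_mem U V)
    (fun g f => A.functor.map_comp (X := ⟨U⟩) (Y := ⟨V⟩) (Z := ⟨W⟩) f g) z'.1 z.1
  rw [SVec.signedMap₂_eq_map₂ _ _ _ (he.parityProj_map z'.1) (he.parityProj_map z.1), ← hcomp]
    at hmap
  refine Subtype.ext (hy''.symm.trans (hmap.trans ?_))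
  exact congrArg₂ (fun a b => GammaV.tcomp k d _ _ _ a b) hy' hy

theorem GammaMap.eq_zero_of_odd (he : A.MapsToEven) {V W : FinSVec k}
    {x : (⟨V⟩ : GammaSV k (d * n)) ⟶ ⟨W⟩}
    (hx : x ∈ Superlinear.homGr (k := k) (⟨V⟩ : GammaSV k (d * n)) ⟨W⟩ 1) {y}
    (h : A.GammaMap hA d x y) : y = 0 := by
  obtain ⟨z, hz, hy⟩ := h
  refine Subtype.ext (hy.symm.trans ?_)
  have h1 := SVec.map_parityProj_of_forall_even _ (mapLin_mem V W) (fun f => he ⟨V⟩ ⟨W⟩ f) 0 z.1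
  rw [if_pos rfl, SVec.parityProj_zero_of_splitTensor_odd _ x.1 hx z.1 hz, map_zero] at h1
  exact h1.symm

/-- Tensors with even factors commute with the weight projections. -/
theorem weightTensor_tcomp_map {X Y : SVec k} {M : Type u} [AddCommGroup M] [Module k M]
    (g : M →ₗ[k] X →ₗ[k] Y) (hg : ∀ m j, ∀ v ∈ X.gr j, g m v ∈ Y.gr j) (j : ℕ) (t : ⨂[k]^d M) :
    GammaV.tcomp k d X Y Y (StrictPoly.weightTensor Y d j) (PiTensorProduct.map (fun _ => g) t) =
      GammaV.tcomp k d X X Y (PiTensorProduct.map (fun _ => g) t)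
        (StrictPoly.weightTensor X d j) := by
  simp only [StrictPoly.weightTensor, map_sum, LinearMap.sum_apply]
  refine Finset.sum_congr rfl fun S _ => ?_
  split_ifs
  swap
  · simp only [map_zero, LinearMap.zero_apply]
  rw [StrictPoly.projTensor, StrictPoly.projTensor]
  induction t using PiTensorProduct.induction_on with
  | smul_tprod r f =>
    rw [map_smul, map_smul, map_smul, LinearMap.smul_apply, PiTensorProduct.map_tprod,
      GammaV.tcomp_tprod, GammaV.tcomp_tprod]
    congr 2
    funext a
    have hc := SVec.proj_comp_of_even _ (hg (f a))
    split_ifs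
    · exact hc 1
    · exact hc 0
  | add t t' ht ht' => simp only [map_add, LinearMap.add_apply, ht, ht']

theorem GammaMap.comp_weightHom (he : A.MapsToEven) {V W : FinSVec k}
    {x : (⟨V⟩ : GammaSV k (d * n)) ⟶ ⟨W⟩} {y} (h : A.GammaMap hA d x y) (j : ℕ) :
    y ≫ StrictPoly.weightHom d (A.fobj hA W) j = StrictPoly.weightHom d (A.fobj hA V) j ≫ y := by
  obtain ⟨z, hz, hy⟩ := h
  refine Subtype.ext ?_
  change GammaV.tcomp k d _ _ _ (StrictPoly.weightTensor (A.functor.obj ⟨W⟩) d j) y.1 =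
    GammaV.tcomp k d _ _ _ y.1 (StrictPoly.weightTensor (A.functor.obj ⟨V⟩) d j)
  rw [← hy]
  refine weightTensor_tcomp_map (A.mapLin V W) (fun f j v hv => ?_) j z.1
  have := he ⟨V⟩ ⟨W⟩ f j v hv
  rwa [zero_add] at this

variable (hA) in
/-- The functor `V ↦ A(V)`, given on morphisms by
`Γ^{d*n} Hom(V,W) → Γ^d (Γ^n Hom(V,W)) → Γ^d Hom(A(V),A(W))`. -/
noncomputable def gammaFunctor (he : A.MapsToEven) (d : ℕ) : GammaSV k (d * n) ⥤ GammaV k d where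
  obj V := GammaV.ofSVec d (A.fobj hA V.base)
  map x := (he.exists_gammaMap hA x).choose
  map_id V := (he.exists_gammaMap hA (𝟙 V)).choose_spec.unique (GammaMap.id V.base)
  map_comp f g := (he.exists_gammaMap hA (f ≫ g)).choose_spec.unique
    (GammaMap.comp he (he.exists_gammaMap hA f).choose_spec (he.exists_gammaMap hA g).choose_spec)

theorem gammaMap_gammaFunctor (he : A.MapsToEven) {V W : GammaSV k (d * n)} (x : V ⟶ W) :
    A.GammaMap hA d x ((A.gammaFunctor hA he d).map x) :=
  (he.exists_gammaMap hA x).choose_spec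

theorem gammaFunctor_map_add (he : A.MapsToEven) {V W : GammaSV k (d * n)} (x x' : V ⟶ W) :
    (A.gammaFunctor hA he d).map (x + x') =
      (A.gammaFunctor hA he d).map x + (A.gammaFunctor hA he d).map x' :=
  (gammaMap_gammaFunctor he _).unique
    ((gammaMap_gammaFunctor he x).add (gammaMap_gammaFunctor he x'))

theorem gammaFunctor_map_smul (he : A.MapsToEven) {V W : GammaSV k (d * n)} (c : k) (x : V ⟶ W) :
    (A.gammaFunctor hA he d).map (c • x) = c • (A.gammaFunctor hA he d).map x :=
  (gammaMap_gammaFunctor he _).unique ((gammaMap_gammaFunctor he x).smul c)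

end Superfunctor

/-! ### Precomposition with a superfunctor -/

namespace StrictPoly

variable {k : Type u} [Field k] {d : ℕ}

/-- A linear map commuting with the weight projections is even. -/
theorem mem_ihom_evalSuper {F G : StrictPoly k d} {X Y : FinSVec k}
    (f : F.functor.obj (GammaV.ofSVec d X) →ₗ[k] G.functor.obj (GammaV.ofSVec d Y))
    (hf : ∀ j, f ∘ₗ weightProj F X j = weightProj G Y j ∘ₗ f) :
    (show SVec.ihom (F.evalSuper X) (G.evalSuper Y) from f) ∈
      (SVec.ihom (F.evalSuper X) (G.evalSuper Y)).gr 0 := by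
  intro i v hv
  rw [zero_add]
  have hle : (⨆ (j : ℕ) (_ : (j : ZMod 2) = i), weightSpace F X j) ≤
      (⨆ (j : ℕ) (_ : (j : ZMod 2) = i), weightSpace G Y j).comap f := by
    refine iSup₂_le fun j hj => ?_
    rintro _ ⟨w, rfl⟩
    refine Submodule.mem_iSup_of_mem j (Submodule.mem_iSup_of_mem hj ⟨f w, ?_⟩)
    exact (LinearMap.congr_fun (hf j) w).symm
  exact hle hv

end StrictPoly

namespace Superfunctor

variable {k : Type u} [Field k] {n d : ℕ} {A : Superfunctor k n}

/-- The superfunctor `F ∘ A`. -/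
noncomputable def precompObj (hA : A.HasFiniteValues) (he : A.MapsToEven) (F : StrictPoly k d) :
    PolySuperEv k (d * n) where
  functor :=
    { obj V := F.evalSuper (A.fobj hA V.base)
      map x := (F.functor.map ((A.gammaFunctor hA he d).map x)).hom
      map_id V := by
        rw [CategoryTheory.Functor.map_id]
        exact congrArg ModuleCat.Hom.hom (F.functor.map_id _)
      map_comp x y := by
        rw [CategoryTheory.Functor.map_comp]
        exact congrArg ModuleCat.Hom.hom (F.functor.map_comp _ _) }
  isSuperlinear :=
    { map_add x y := by
        change (F.functor.map ((A.gammaFunctor hA he d).map (x + y))).hom = _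
        rw [gammaFunctor_map_add, F.functor.map_add]
        rfl
      map_smul c x := by
        change (F.functor.map ((A.gammaFunctor hA he d).map (c • x))).hom = _
        rw [gammaFunctor_map_smul, F.functor.map_smul]
        rfl
      map_mem {V W} i x hx := by
        have par : ∀ a : ZMod 2, a = 0 ∨ a = 1 := by decide
        rcases par i with rfl | rfl
        · refine StrictPoly.mem_ihom_evalSuper (F := F) (G := F) (X := A.fobj hA V.base)
            (Y := A.fobj hA W.base) _ fun j => ?_
          have h := (gammaMap_gammaFunctor (hA := hA) he x).comp_weightHom he j
          exact congrArg ModuleCat.Hom.hom ((F.functor.map_comp _ _).symm.trans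
            ((congrArg F.functor.map h.symm).trans (F.functor.map_comp _ _)))
        · have h := (gammaMap_gammaFunctor (hA := hA) he x).eq_zero_of_odd he hx
          have h' : (F.functor.map ((A.gammaFunctor hA he d).map x)).hom = 0 :=
            congrArg ModuleCat.Hom.hom
              ((congrArg F.functor.map h).trans (F.functor.map_zero _ _))
          exact (congrArg (· ∈ SVec.ihomGr (F.evalSuper (A.fobj hA V.base))
            (F.evalSuper (A.fobj hA W.base)) 1) h').mpr (zero_mem _) }
  finite V := F.finite _

/-- Precomposition by `A`, as a functor `𝒫_d ⥤ (𝐏_{d*n})_ev`. -/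
noncomputable def precomp (hA : A.HasFiniteValues) (he : A.MapsToEven) (d : ℕ) :
    StrictPoly k d ⥤ PolySuperEv k (d * n) where
  obj F := precompObj hA he F
  map φ :=
    { nat :=
        { app V := (NatTrans.app φ (GammaV.ofSVec d (A.fobj hA V.base))).hom
          naturality _ _ x := congrArg ModuleCat.Hom.hom
            (NatTrans.naturality φ ((A.gammaFunctor hA he d).map x)) }
      even V := StrictPoly.mem_ihom_evalSuper _ fun j =>
        (congrArg ModuleCat.Hom.hom (NatTrans.naturality φ
          (StrictPoly.weightHom d (A.fobj hA V.base) j))) }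
  map_id _ := rfl
  map_comp _ _ := rfl

theorem isPrecomposition_precomp (hA : A.HasFiniteValues) (he : A.MapsToEven) (d : ℕ) :
    A.IsPrecomposition hA (precomp hA he d) :=
  ⟨fun _ _ => LinearEquiv.refl k _, fun _ _ _ _ => Iff.rfl,
    fun _ _ _ x => ⟨_, gammaMap_gammaFunctor he x, fun _ => rfl⟩, fun _ _ _ _ _ => rfl⟩

end Superfunctor

/-! ### Exactness -/

open CategoryTheory.Limits

namespace StrictPoly

variable (k : Type u) [Field k] (d : ℕ)

/-- The inclusion of strict polynomial functors into all functors `Γ^d 𝒱 ⥤ Mod k`. -/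
def toFunctor : StrictPoly k d ⥤ (GammaV k d ⥤ ModuleCat.{u} k) where
  obj F := F.functor
  map φ := φ

instance : (toFunctor k d).Full := ⟨fun f => ⟨f, rfl⟩⟩

instance : (toFunctor k d).Faithful := ⟨fun h => h⟩

variable {k d} {J : Type} [SmallCategory J]

section Lim

variable (K : J ⥤ (GammaV k d ⥤ ModuleCat.{u} k))

theorem additive_limit (hK : ∀ j, (K.obj j).Additive) : (limit K).Additive where
  map_add {X Y f g} := by
    have key : ∀ (f : X ⟶ Y) j, (limit K).map f ≫ (limit.π K j).app Y =
      (limit.π K j).app X ≫ (K.obj j).map f := fun f j => (limit.π K j).naturality f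
    refine (isLimitOfPreserves ((evaluation _ _).obj Y) (limit.isLimit K)).hom_ext fun j => ?_
    change _ ≫ (limit.π K j).app Y = _ ≫ (limit.π K j).app Y
    have := hK j
    rw [Preadditive.add_comp, key, key, key, Functor.map_add, Preadditive.comp_add]

theorem linear_limit (hK : ∀ j, (K.obj j).Linear k) : (limit K).Linear k where
  map_smul {X Y} f c := by
    have key : ∀ (f : X ⟶ Y) j, (limit K).map f ≫ (limit.π K j).app Y =
      (limit.π K j).app X ≫ (K.obj j).map f := fun f j => (limit.π K j).naturality f
    refine (isLimitOfPreserves ((evaluation _ _).obj Y) (limit.isLimit K)).hom_ext fun j => ?_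
    change _ ≫ (limit.π K j).app Y = _ ≫ (limit.π K j).app Y
    have := hK j
    rw [Linear.smul_comp, key, key, Functor.map_smul, Linear.comp_smul]

theorem additive_colimit (hK : ∀ j, (K.obj j).Additive) : (colimit K).Additive where
  map_add {X Y f g} := by
    have key : ∀ (f : X ⟶ Y) j, (colimit.ι K j).app X ≫ (colimit K).map f =
      (K.obj j).map f ≫ (colimit.ι K j).app Y := fun f j => ((colimit.ι K j).naturality f).symm
    refine (isColimitOfPreserves ((evaluation _ _).obj X) (colimit.isColimit K)).hom_ext
      fun j => ?_
    change (colimit.ι K j).app X ≫ _ = (colimit.ι K j).app X ≫ _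
    have := hK j
    rw [Preadditive.comp_add, key, key, key, Functor.map_add, Preadditive.add_comp]

theorem linear_colimit (hK : ∀ j, (K.obj j).Linear k) : (colimit K).Linear k where
  map_smul {X Y} f c := by
    have key : ∀ (f : X ⟶ Y) j, (colimit.ι K j).app X ≫ (colimit K).map f =
      (K.obj j).map f ≫ (colimit.ι K j).app Y := fun f j => ((colimit.ι K j).naturality f).symm
    refine (isColimitOfPreserves ((evaluation _ _).obj X) (colimit.isColimit K)).hom_ext
      fun j => ?_
    change (colimit.ι K j).app X ≫ _ = (colimit.ι K j).app X ≫ _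
    have := hK j
    rw [Linear.comp_smul, key, key, Functor.map_smul, Linear.smul_comp]

theorem finite_limit [FinCategory J] (hK : ∀ j X, FiniteDimensional k ((K.obj j).obj X))
    (X : GammaV k d) :
    FiniteDimensional k ((limit K).obj X) := by
  have : ∀ j, Module.Finite k ((K ⋙ (evaluation _ _).obj X).obj j) := fun j => hK j X
  have : Module.Finite k (limit (K ⋙ (evaluation _ _).obj X) : ModuleCat.{u} k) :=
    Module.Finite.of_injective (limitSubobjectProduct (K ⋙ (evaluation _ _).obj X)).hom
      ((ModuleCat.mono_iff_injective _).1 inferInstance)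
  exact Module.Finite.equiv (limitObjIsoLimitCompEvaluation K X).symm.toLinearEquiv

theorem finite_colimit [FinCategory J] (hK : ∀ j X, FiniteDimensional k ((K.obj j).obj X))
    (X : GammaV k d) :
    FiniteDimensional k ((colimit K).obj X) := by
  have : ∀ j, Module.Finite k ((K ⋙ (evaluation _ _).obj X).obj j) := fun j => hK j X
  have : Module.Finite k (colimit (K ⋙ (evaluation _ _).obj X) : ModuleCat.{u} k) :=
    Module.Finite.of_surjective (colimitQuotientCoproduct (K ⋙ (evaluation _ _).obj X)).hom
      ((ModuleCat.epi_iff_surjective _).1 inferInstance)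
  exact Module.Finite.equiv (colimitObjIsoColimitCompEvaluation K X).symm.toLinearEquiv

end Lim

noncomputable instance [FinCategory J] : CreatesLimitsOfShape J (toFunctor k d) where
  CreatesLimit {K} := createsLimitOfFullyFaithfulOfIso
    { functor := limit (K ⋙ toFunctor k d)
      additive := additive_limit _ fun j => (K.obj j).additive
      linear := linear_limit _ fun j => (K.obj j).linear
      finite := finite_limit _ fun j => (K.obj j).finite } (Iso.refl _)

noncomputable instance [FinCategory J] : CreatesColimitsOfShape J (toFunctor k d) where
  CreatesColimit {K} := createsColimitOfFullyFaithfulOfIso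
    { functor := colimit (K ⋙ toFunctor k d)
      additive := additive_colimit _ fun j => (K.obj j).additive
      linear := linear_colimit _ fun j => (K.obj j).linear
      finite := finite_colimit _ fun j => (K.obj j).finite } (Iso.refl _)

end StrictPoly

namespace SVec

variable (k : Type u) [Field k]

/-- The functor forgetting the grading. -/
def toModule : SVec k ⥤ ModuleCat.{u} k where
  obj V := ModuleCat.of k V.carrier
  map f := ModuleCat.ofHom (toLin f)

variable {k}

theorem mem_homGr_zero_iff {V W : SVec k} (f : V ⟶ W) :
    f ∈ Superlinear.homGr (k := k) V W 0 ↔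
      ModuleCat.ofHom (V.proj 0) ≫ (toModule k).map f =
        (toModule k).map f ≫ ModuleCat.ofHom (W.proj 0) := by
  constructor
  · intro hf
    refine ModuleCat.hom_ext (proj_comp_of_even (toLin f) (fun j v hv => ?_) 0).symm
    have := hf j v hv
    rwa [zero_add] at this
  · intro h j v hv
    have h0 : ∀ v, toLin f (V.proj 0 v) = W.proj 0 (toLin f v) := fun v =>
      LinearMap.congr_fun (congrArg ModuleCat.Hom.hom h) v
    change toLin f v ∈ W.gr (0 + j)
    rw [zero_add]
    have par : ∀ a : ZMod 2, a = 0 ∨ a = 1 := by decide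
    rcases par j with rfl | rfl
    · have hp := h0 v
      rw [V.proj_of_mem 0 0 v hv, if_pos rfl] at hp
      rw [hp]
      exact W.proj_mem 0 _
    · have hp := h0 v
      rw [mem_gr_iff_proj_add_one]
      rw [mem_gr_iff_proj_add_one] at hv
      change V.proj 0 v = 0 at hv
      rw [hv, map_zero] at hp
      exact hp.symm

end SVec

namespace PolySuperEv

variable (k : Type u) [Field k] (n : ℕ)

/-- The functor forgetting the grading of the values. -/
noncomputable def toFunctor : PolySuperEv k n ⥤ (GammaSV k n ⥤ ModuleCat.{u} k) where
  obj F := F.functor ⋙ SVec.toModule k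
  map φ := Functor.whiskerRight φ.nat (SVec.toModule k)

variable {k n}

/-- A natural transformation with even components, from one of the underlying functors. -/
noncomputable def homOfEven {F G : PolySuperEv k n}
    (φ : (toFunctor k n).obj F ⟶ (toFunctor k n).obj G)
    (h : ∀ V, ModuleCat.ofHom ((F.functor.obj V).proj 0) ≫ φ.app V =
      φ.app V ≫ ModuleCat.ofHom ((G.functor.obj V).proj 0)) : F ⟶ G where
  nat :=
    { app V := (φ.app V).hom
      naturality _ _ f := congrArg ModuleCat.Hom.hom (φ.naturality f) }
  even V := (SVec.mem_homGr_zero_iff _).2 (h V)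

theorem proj_comp_map {F G : PolySuperEv k n} (φ : F ⟶ G) (V : GammaSV k n) :
    ModuleCat.ofHom ((F.functor.obj V).proj 0) ≫ ((toFunctor k n).map φ).app V =
      ((toFunctor k n).map φ).app V ≫ ModuleCat.ofHom ((G.functor.obj V).proj 0) :=
  (SVec.mem_homGr_zero_iff _).1 (φ.even V)

instance : (toFunctor k n).Faithful where
  map_injective {F G φ ψ} h := by
    refine Hom.ext (NatTrans.ext (funext fun V => ?_))
    exact congrArg ModuleCat.Hom.hom (NatTrans.congr_app h V)

section

variable {C : Type*} [Category C] {X Y Z : C} {p : X ⟶ X} {q : Y ⟶ Y} {r : Z ⟶ Z}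

/-- If `f = l ≫ g` and `g` commute with the given endomorphisms, so does `l` after composition
with `g`. -/
theorem comp_comp_eq_of_comp_eq {l : X ⟶ Y} {f : X ⟶ Z} {g : Y ⟶ Z} (hf : p ≫ f = f ≫ r)
    (hg : q ≫ g = g ≫ r) (h : l ≫ g = f) : (p ≫ l) ≫ g = (l ≫ q) ≫ g := by
  rw [Category.assoc, h, Category.assoc, hg, ← Category.assoc, h, hf]

theorem comp_comp_eq_of_eq_comp {f : X ⟶ Z} {g : X ⟶ Y} {l : Y ⟶ Z} (hf : p ≫ f = f ≫ r)
    (hg : p ≫ g = g ≫ q) (h : g ≫ l = f) : g ≫ q ≫ l = g ≫ l ≫ r := by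
  rw [← Category.assoc, ← hg, Category.assoc, h, ← Category.assoc, h, hf]

end

variable {J : Type} [SmallCategory J]

/-- The comparison with a limit of the underlying functors is even, because the projections of
the limit are even and jointly injective. -/
instance : ReflectsLimitsOfShape J (toFunctor k n) where
  reflectsLimit {K} :=
    { reflects {c} hc := ⟨
        { lift s := homOfEven (hc.lift ((toFunctor k n).mapCone s)) fun V => by
            refine (isLimitOfPreserves ((evaluation _ _).obj V) hc).hom_ext fun j => ?_
            exact comp_comp_eq_of_comp_eq (proj_comp_map (s.π.app j) V)
              (proj_comp_map (c.π.app j) V)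
              (NatTrans.congr_app (hc.fac ((toFunctor k n).mapCone s) j) V)
          fac s j := (toFunctor k n).map_injective (hc.fac ((toFunctor k n).mapCone s) j)
          uniq s m hm := (toFunctor k n).map_injective
            (hc.uniq ((toFunctor k n).mapCone s) _ fun j =>
              congrArg (toFunctor k n).map (hm j)) }⟩ }

/-- The comparison with a colimit of the underlying functors is even, because the coprojections
are even and jointly surjective. -/
instance : ReflectsColimitsOfShape J (toFunctor k n) where
  reflectsColimit {K} :=
    { reflects {c} hc := ⟨
        { desc s := homOfEven (hc.desc ((toFunctor k n).mapCocone s)) fun V => by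
            refine (isColimitOfPreserves ((evaluation _ _).obj V) hc).hom_ext fun j => ?_
            exact comp_comp_eq_of_eq_comp (proj_comp_map (s.ι.app j) V)
              (proj_comp_map (c.ι.app j) V)
              (NatTrans.congr_app (hc.fac ((toFunctor k n).mapCocone s) j) V)
          fac s j := (toFunctor k n).map_injective (hc.fac ((toFunctor k n).mapCocone s) j)
          uniq s m hm := (toFunctor k n).map_injective
            (hc.uniq ((toFunctor k n).mapCocone s) _ fun j =>
              congrArg (toFunctor k n).map (hm j)) }⟩ }

end PolySuperEv

namespace Superfunctor

variable {k : Type u} [Field k] {n : ℕ} {A : Superfunctor k n}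

/-- On underlying functors, precomposition by `A` is precomposition with the functor
`Γ^{d*n} 𝐕 ⥤ Γ^d 𝒱` induced by `A`. -/
noncomputable def precompCompToFunctorIso (hA : A.HasFiniteValues) (he : A.MapsToEven) (d : ℕ) :
    precomp hA he d ⋙ PolySuperEv.toFunctor k (d * n) ≅
      StrictPoly.toFunctor k d ⋙
        (Functor.whiskeringLeft _ _ _).obj (A.gammaFunctor hA he d) := Iso.refl _

theorem preservesFiniteLimits_precomp (hA : A.HasFiniteValues) (he : A.MapsToEven) (d : ℕ) :
    PreservesFiniteLimits (precomp hA he d) where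
  preservesFiniteLimits J _ _ := by
    have : PreservesLimitsOfShape J (precomp hA he d ⋙ PolySuperEv.toFunctor k (d * n)) :=
      preservesLimitsOfShape_of_natIso (precompCompToFunctorIso hA he d).symm
    exact preservesLimitsOfShape_of_reflects_of_preserves _ (PolySuperEv.toFunctor k (d * n))

theorem preservesFiniteColimits_precomp (hA : A.HasFiniteValues) (he : A.MapsToEven) (d : ℕ) :
    PreservesFiniteColimits (precomp hA he d) where
  preservesFiniteColimits J _ _ := by
    have : PreservesColimitsOfShape J (precomp hA he d ⋙ PolySuperEv.toFunctor k (d * n)) :=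
      preservesColimitsOfShape_of_natIso (precompCompToFunctorIso hA he d).symm
    exact preservesColimitsOfShape_of_reflects_of_preserves _ (PolySuperEv.toFunctor k (d * n))

end Superfunctor

theorem mainTheorem3 {k : Type u} [Field k] (p : ℕ) [Fact p.Prime] [CharP k p] (hp : 3 ≤ p)
    (r : ℕ) (hr : 0 < r) (A : Superfunctor k (p ^ r)) (hA : A.IsAdditive) :
    (∀ (V W : GammaSV k (p ^ r)) (f : V ⟶ W),
      A.functor.map f ∈ Superlinear.homGr (k := k) (A.functor.obj V) (A.functor.obj W) 0) ∧
    (∃ B : GammaSV k (p ^ r) ⥤ Ev k (SVec k),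
      IsSuperlinear k B ∧ B ⋙ Ev.incl k (SVec k) = A.functor) ∧
    ∀ (hfin : A.HasFiniteValues) (d : ℕ),
      ∃ Φ : StrictPoly k d ⥤ PolySuperEv k (d * p ^ r),
        A.IsPrecomposition hfin Φ ∧
        Limits.PreservesFiniteLimits Φ ∧ Limits.PreservesFiniteColimits Φ := by
  have h2 : (2 : k) ≠ 0 := by
    intro h
    have h' : ((2 : ℕ) : k) = 0 := by exact_mod_cast h
    exact absurd (Nat.le_of_dvd two_pos ((CharP.cast_eq_zero_iff k p 2).1 h')) (by omega)
  have hn : 2 ≤ p ^ r := le_trans (by omega) (Nat.le_self_pow hr.ne' p)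
  have he : A.MapsToEven := hA.mapsToEven h2 hn
  exact ⟨he, ⟨A.toEv he, A.isSuperlinear_toEv he, A.toEv_comp_incl he⟩,
    fun hfin d => ⟨Superfunctor.precomp hfin he d, Superfunctor.isPrecomposition_precomp hfin he d,
      Superfunctor.preservesFiniteLimits_precomp hfin he d,
      Superfunctor.preservesFiniteColimits_precomp hfin he d⟩⟩
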